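/- Let $\ell^2(\mathbb N)$ be the complex Hilbert space of square-summable sequences, let $\mathcal B(\ell^2(\mathbb N))$ be the algebra of bounded linear operators on it, and let $\mathcal D\subset\mathcal B(\ell^2(\mathbb N))$ be the algebra of operators that are diagonal in the standard basis, i.e. the bounded operators $T$ of the form $(Tx)_n=d_nx_n$ for some complex sequence $(d_n)$. A *state* on $\mathcal A\in\{\mathcal D,\mathcal B(\ell^2(\mathbb N))\}$ is a bounded linear functional $s:\mathcal A\to\mathbb C$ such that $s(A)\ge 0$ for every positive operator $A\in\mathcal A$ and $s(\mathbf I)=1$. A state $s$ is *pure* if it is not a proper convex combination of other states: whenever $s=\theta s_1+(1-\theta)s_2$ with $0<\theta<1$ and states $s_1,s_2$ on $\mathcal A$, then $s_1=s_2=s$. **Theorem (Kadison–Singer problem).** Let $s:\mathcal D\to\mathbb C$ be a pure state. Then there exists a unique state $\tilde s:\mathcal B(\ell^2(\mathbb N))\to\mathbb C$ that extends $s$, i.e. such that $\tilde s(A)=s(A)$ for all $A\in\mathcal D$. -/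

import Mathlib

namespace KadisonSinger

/-- The complex Hilbert space `ℓ²(ℕ)`. -/
abbrev Ell2 : Type := lp (fun _ : ℕ => ℂ) 2

/-- `B(ℓ²(ℕ))`, the algebra of bounded operators on `ℓ²(ℕ)`; its order is the Loewner order
(`0 ≤ T` iff `T` is a positive operator) and its star is the adjoint. -/
abbrev BEll2 : Type := Ell2 →L[ℂ] Ell2

/-- `T` is diagonal with respect to the standard basis: for some sequence `d`, it maps
`(x n)` to `(d n * x n)`. -/
def IsDiagonal (T : BEll2) : Prop :=
  ∃ d : ℕ → ℂ, ∀ (x : Ell2) (n : ℕ), T x n = d n * x n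

theorem IsDiagonal.adjoint {T : BEll2} (h : IsDiagonal T) : IsDiagonal (star T) := by
  obtain ⟨d, hd⟩ := h
  refine ⟨fun n => star (d n), fun x n => ?_⟩
  have key : T (lp.single 2 n (1 : ℂ)) = lp.single 2 n (d n) := by
    ext k
    rw [hd]
    by_cases hk : k = n
    · subst hk
      simp
    · simp [hk]
  have h1 := ContinuousLinearMap.adjoint_inner_right T (lp.single 2 n (1 : ℂ)) x
  rw [key, lp.inner_single_left, lp.inner_single_left] at h1
  simpa [ContinuousLinearMap.star_eq_adjoint, mul_comm] using h1

/-- The algebra `𝓓 ⊆ B(ℓ²(ℕ))` of diagonal operators. As a subtype of `B(ℓ²(ℕ))` it carries the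
operator norm and the Loewner order. -/
def diagonalAlgebra : StarSubalgebra ℂ BEll2 where
  carrier := {T | IsDiagonal T}
  mul_mem' := by
    rintro S T ⟨d, hd⟩ ⟨e, he⟩
    exact ⟨fun n => d n * e n, fun x n => by
      rw [mul_apply_eq_comp, hd, he, mul_assoc]⟩
  add_mem' := by
    rintro S T ⟨d, hd⟩ ⟨e, he⟩
    exact ⟨fun n => d n + e n, fun x n => by
      rw [add_apply, lp.coeFn_add, Pi.add_apply, hd, he, add_mul]⟩
  algebraMap_mem' := by
    intro c
    exact ⟨fun _ => c, fun x n => by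
      simp [Algebra.algebraMap_eq_smul_one]⟩
  star_mem' := fun h => IsDiagonal.adjoint h

section States

variable {A : Type*} [Ring A] [Algebra ℂ A] [TopologicalSpace A] [PartialOrder A]

open scoped ComplexOrder in
/-- A bounded linear functional is a state if it is positive and sends the unit to `1`.
In `ℂ`, `0 ≤ z` means that `z` is real and nonnegative. -/
def IsState (s : A →L[ℂ] ℂ) : Prop :=
  (∀ a : A, 0 ≤ a → 0 ≤ s a) ∧ s 1 = 1

/-- A state is pure if it is not a proper convex combination of other states. -/
def IsPureState (s : A →L[ℂ] ℂ) : Prop :=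
  IsState s ∧ ∀ (s₁ s₂ : A →L[ℂ] ℂ) (θ : ℝ), IsState s₁ → IsState s₂ → 0 < θ → θ < 1 →
    s = (θ : ℂ) • s₁ + ((1 - θ : ℝ) : ℂ) • s₂ → s₁ = s ∧ s₂ = s

end States

end KadisonSinger

/-! Existence is easy: compose `s` with the conditional expectation `diagPart`, which keeps only the
diagonal of an operator. For uniqueness, every extension must be shown to vanish on operators with
zero diagonal, and this follows from paving. A pure state of the diagonal algebra takes only the
values 0 and 1 on coordinate projections (`IsPureState.proj_eq`), so whenever ℕ is split into
finitely many classes, exactly one class has mass 1. If a self-adjoint `A` with zero diagonal can be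
compressed to a set of mass 1 where its quadratic form lies in `[-ε, ε]`, then positivity forces any
extension to have absolute value at most `ε`, up to an arbitrarily small error, on `A`
(`le_of_formLE`).

Such sets come from iterating a weak paving statement: five colours suffice to bring the upper bound
of the form down by the factor 9999/10000 on each class (`exists_paving_upper`). It is applied to
`A` and to `-A` in turn, and it reduces by compactness to finite matrices (`exists_finite_paving`).

For a Hermitian matrix `A` put `P T = det (diagonal X - A)` with the rows in `T` erased. Erasing row
`j` is the same as applying `∂ⱼ`, so four derivatives in each variable applied to `(P ∅)^5` give a
positive multiple of the sum, over all 5-colourings, of the products of the polynomials of the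
colour classes. Two facts about real stable polynomials finish the argument.

(1) Barrier (`barrier_pderivFour`): the summed polynomial is positive on the orthant above a point
with all coordinates below 1. The start is 101/100, where zero diagonal and convexity of the
resolvent bound the logarithmic derivatives (`adjugate_le`). Each group of four derivatives allows a
shift down of one coordinate, and the shifts add up to more than 1/100 per coordinate.

(2) Selection (`exists_colouring`): the colours can be fixed one variable at a time while keeping
positivity above the same point, so some single colouring satisfies the bound of the sum. -/

namespace KadisonSinger

open MvPolynomial Filter Topology ComplexConjugate

/-! ### Restriction of a real polynomial to lines -/

section Line

variable {σ K : Type*} [CommRing K] [Algebra ℝ K]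

/-- The univariate polynomial `τ ↦ q (z + τ v)`. -/
noncomputable def line (q : MvPolynomial σ ℝ) (z v : σ → K) : Polynomial K :=
  aeval (fun i => Polynomial.C (z i) + Polynomial.C (v i) * Polynomial.X) q

theorem eval_line (q : MvPolynomial σ ℝ) (z v : σ → K) (τ : K) :
    (line q z v).eval τ = aeval (fun i => z i + v i * τ) q := by
  have h : ((Polynomial.aeval τ).restrictScalars ℝ).comp
      (aeval (fun i => Polynomial.C (z i) + Polynomial.C (v i) * Polynomial.X)) =
      (aeval (fun i => z i + v i * τ) : MvPolynomial σ ℝ →ₐ[ℝ] K) := by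
    ext i
    simp
  have := DFunLike.congr_fun h q
  simpa [line, Polynomial.coe_aeval_eq_eval] using this

theorem derivative_line [Fintype σ] (q : MvPolynomial σ ℝ) (z v : σ → K) :
    Polynomial.derivative (line q z v) =
      ∑ i, Polynomial.C (v i) * line (pderiv i q) z v := by
  classical
  unfold line
  induction q using MvPolynomial.induction_on with
  | C a =>
    rw [algHom_C, IsScalarTower.algebraMap_apply ℝ K (Polynomial K)]
    simp
  | add p q hp hq =>
    simp only [map_add, hp, hq, mul_add, Finset.sum_add_distrib]
  | mul_X p i hp =>
    have h1 : ∀ j, pderiv j (p * X i) = p * (if i = j then 1 else 0) + X i * pderiv j p := by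
      intro j
      rw [Derivation.leibniz, smul_eq_mul, smul_eq_mul]
      by_cases h : i = j
      · subst h; simp
      · simp [h, pderiv_X_of_ne h]
    set L := aeval (R := ℝ) (fun i => Polynomial.C (z i) + Polynomial.C (v i) * Polynomial.X)
    have h2 : ∀ j, Polynomial.C (v j) * L (pderiv j (p * X i)) =
        (if j = i then L p * Polynomial.C (v i) else 0) +
          L (X i) * (Polynomial.C (v j) * L (pderiv j p)) := by
      intro j
      rw [h1, map_add, map_mul, map_mul]
      by_cases h : j = i
      · subst h; simp; ring
      · simp [h, Ne.symm h]; ring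
    rw [Finset.sum_congr rfl fun j _ => h2 j, Finset.sum_add_distrib, ← Finset.mul_sum, ← hp,
      map_mul, Polynomial.derivative_mul]
    simp [L]
    ring

theorem natDegree_line_le (q : MvPolynomial σ ℝ) (z v : σ → K) :
    (line q z v).natDegree ≤ q.totalDegree := by
  classical
  rw [line, aeval_def, eval₂_eq]
  refine Polynomial.natDegree_sum_le_of_forall_le _ _ fun d hd => ?_
  refine Polynomial.natDegree_mul_le.trans ?_
  rw [IsScalarTower.algebraMap_apply ℝ K (Polynomial K), Polynomial.algebraMap_eq,
    Polynomial.natDegree_C, zero_add]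
  refine (Polynomial.natDegree_prod_le _ _).trans ?_
  refine le_trans ?_ (le_totalDegree hd)
  refine Finset.sum_le_sum fun i _ => ?_
  refine Polynomial.natDegree_pow_le.trans ?_
  have : (Polynomial.C (z i) + Polynomial.C (v i) * Polynomial.X).natDegree ≤ 1 := by
    compute_degree
  nlinarith

end Line

section Eval

variable {σ : Type*}

theorem ofReal_aeval (q : MvPolynomial σ ℝ) (x : σ → ℝ) :
    ((aeval x q : ℝ) : ℂ) = aeval (fun i => (x i : ℂ)) q := by
  have h : (Complex.ofRealAm).comp (aeval x) =
      (aeval (fun i => (x i : ℂ)) : MvPolynomial σ ℝ →ₐ[ℝ] ℂ) := by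
    ext i
    simp
  simpa using DFunLike.congr_fun h q

theorem conj_aeval (q : MvPolynomial σ ℝ) (z : σ → ℂ) :
    conj (aeval z q) = aeval (fun i => conj (z i)) q := by
  have h : (Complex.conjAe : ℂ →ₐ[ℝ] ℂ).comp (aeval z) =
      (aeval (fun i => conj (z i)) : MvPolynomial σ ℝ →ₐ[ℝ] ℂ) := by
    ext i
    simp
  simpa using DFunLike.congr_fun h q

theorem continuous_aeval' {K X : Type*} [CommRing K] [Algebra ℝ K] [TopologicalSpace K]
    [IsTopologicalRing K] [TopologicalSpace X] (q : MvPolynomial σ ℝ) {g : X → σ → K}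
    (hg : Continuous g) : Continuous fun x => aeval (g x) q := by
  simp only [aeval_def, eval₂_eq]
  refine continuous_finsetSum _ fun d _ => continuous_const.mul ?_
  exact continuous_finsetProd _ fun i _ => ((continuous_apply i).comp hg).pow _

theorem map_line (q : MvPolynomial σ ℝ) (x v : σ → ℝ) :
    (line q x v).map (algebraMap ℝ ℂ) = line q (fun i => (x i : ℂ)) (fun i => (v i : ℂ)) := by
  have h : (Polynomial.mapAlgHom (Algebra.ofId ℝ ℂ)).comp
      (aeval (fun i => Polynomial.C (x i) + Polynomial.C (v i) * Polynomial.X)) =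
      (aeval (fun i => Polynomial.C (x i : ℂ) + Polynomial.C (v i : ℂ) * Polynomial.X) :
        MvPolynomial σ ℝ →ₐ[ℝ] Polynomial ℂ) := by
    ext i : 1
    simp
  have := DFunLike.congr_fun h q
  simpa [line] using this

end Eval

/-! ### Real stable polynomials -/

variable {σ : Type*}

/-- `q` has no zeros with all coordinates in the open upper half plane. -/
def Stable (q : MvPolynomial σ ℝ) : Prop :=
  ∀ z : σ → ℂ, (∀ i, 0 < (z i).im) → aeval z q ≠ 0

/-- `q` is positive on the orthant with apex `w`. -/
def Above (q : MvPolynomial σ ℝ) (w : σ → ℝ) : Prop :=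
  ∀ x : σ → ℝ, w ≤ x → 0 < aeval x q

theorem Above.mono {q : MvPolynomial σ ℝ} {w w' : σ → ℝ} (h : Above q w) (hw : w ≤ w') :
    Above q w' := fun x hx => h x (hw.trans hx)

theorem Stable.mul {p q : MvPolynomial σ ℝ} (hp : Stable p) (hq : Stable q) :
    Stable (p * q) := fun z hz => by
  rw [map_mul]; exact mul_ne_zero (hp z hz) (hq z hz)

theorem Above.mul {p q : MvPolynomial σ ℝ} {w : σ → ℝ} (hp : Above p w) (hq : Above q w) :
    Above (p * q) w := fun x hx => by
  rw [map_mul]; exact mul_pos (hp x hx) (hq x hx)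

theorem Stable.im_root_line {q : MvPolynomial σ ℝ} (hq : Stable q) {x v : σ → ℝ}
    (hv : ∀ i, 0 < v i) {r : ℂ}
    (hr : aeval (fun i => (x i : ℂ) + v i * r) q = 0) : r.im = 0 := by
  rcases lt_trichotomy r.im 0 with h | h | h
  · exfalso
    refine hq (fun i => (x i : ℂ) + v i * conj r) (fun i => ?_) ?_
    · simpa using mul_pos (hv i) (neg_pos.2 h)
    · have := congrArg conj hr
      rw [conj_aeval] at this
      simpa using this
  · exact h
  · exfalso
    refine hq (fun i => (x i : ℂ) + v i * r) (fun i => ?_) hr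
    simpa using mul_pos (hv i) h

/-- A quantitative form of the fact that the roots of `τ ↦ q (x + τ v)` are real. -/
theorem Stable.norm_aeval_le {q : MvPolynomial σ ℝ} (hq : Stable q) {x v : σ → ℝ}
    (hv : ∀ i, 0 < v i) (τ : ℝ) {n : ℕ} (hn : q.totalDegree ≤ n) :
    |aeval (fun i => x i + v i * τ) q| ≤
      (1 + |τ|) ^ n * ‖aeval (fun i => (x i : ℂ) + v i * Complex.I) q‖ := by
  set P : Polynomial ℂ := line q (fun i => (x i : ℂ)) (fun i => (v i : ℂ)) with hP
  have hP0 : P ≠ 0 := by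
    intro h0
    have := eval_line q (fun i => (x i : ℂ)) (fun i => (v i : ℂ)) Complex.I
    rw [← hP, h0, Polynomial.eval_zero] at this
    exact hq _ (by simpa using hv) this.symm
  have hs : P.Splits := IsAlgClosed.splits P
  have e1 : |aeval (fun i => x i + v i * τ) q| = ‖P.eval (τ : ℂ)‖ := by
    rw [hP, eval_line, ← Real.norm_eq_abs, ← Complex.norm_real, ofReal_aeval]
    simp
  have e2 : aeval (fun i => (x i : ℂ) + v i * Complex.I) q = P.eval Complex.I := by
    rw [hP, eval_line]
  rw [e1, e2, hs.eval_eq_prod_roots, hs.eval_eq_prod_roots, norm_mul, norm_mul]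
  have hroot : ∀ r ∈ P.roots, r.im = 0 := fun r hr => by
    have := (Polynomial.mem_roots hP0).1 hr
    rw [Polynomial.IsRoot, hP, eval_line] at this
    exact hq.im_root_line hv this
  have key : ∀ s : Multiset ℂ, (∀ r ∈ s, r.im = 0) →
      ‖(s.map fun r => (τ : ℂ) - r).prod‖ ≤
        (1 + |τ|) ^ s.card * ‖(s.map fun r => Complex.I - r).prod‖ := by
    intro s
    induction s using Multiset.induction_on with
    | empty => simp
    | cons r s ih =>
      intro hs
      have ihs := ih fun r' hr' => hs r' (Multiset.mem_cons_of_mem hr')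
      have hr := hs r (Multiset.mem_cons_self r s)
      -- For real `r`, `|I - r|` dominates both 1 and `|r|`, hence `|τ| + |r| ≤ (1 + |τ|) |I - r|`.
      have h1 : ‖(τ : ℂ) - r‖ ≤ (1 + |τ|) * ‖Complex.I - r‖ := by
        have a1 : 1 ≤ ‖Complex.I - r‖ := by
          have := Complex.abs_im_le_norm (Complex.I - r)
          simpa [hr] using this
        have a2 : ‖r‖ ≤ ‖Complex.I - r‖ := by
          have h2 := Complex.abs_re_le_norm (Complex.I - r)
          have h3 : ‖r‖ = |r.re| := by
            exact (Complex.abs_re_eq_norm.2 hr).symm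
          simpa [h3] using h2
        have a3 : ‖(τ : ℂ) - r‖ ≤ |τ| + ‖r‖ := by
          simpa using norm_sub_le (τ : ℂ) r
        nlinarith [abs_nonneg τ]
      simp only [Multiset.map_cons, Multiset.prod_cons, norm_mul, Multiset.card_cons, pow_succ]
      calc _ ≤ ((1 + |τ|) * ‖Complex.I - r‖) *
            ((1 + |τ|) ^ s.card * ‖(s.map fun r => Complex.I - r).prod‖) := by gcongr
        _ = _ := by ring
  have hcard : P.roots.card ≤ n :=
    (Polynomial.card_roots' P).trans ((natDegree_line_le _ _ _).trans hn)
  calc _ ≤ ‖P.leadingCoeff‖ * ((1 + |τ|) ^ P.roots.card *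
        ‖(P.roots.map fun r => Complex.I - r).prod‖) := by gcongr; exact key _ hroot
    _ ≤ ‖P.leadingCoeff‖ * ((1 + |τ|) ^ n *
        ‖(P.roots.map fun r => Complex.I - r).prod‖) := by
        gcongr; linarith [abs_nonneg τ]
    _ = _ := by ring

/-- Directions with some zero coordinates are limits of strictly positive ones. The estimate of
`Stable.norm_aeval_le` is uniform in the direction, so it survives the limit and plays the role of
Hurwitz's theorem. -/
theorem Stable.aeval_line_ne_zero {q : MvPolynomial σ ℝ} (hq : Stable q) {x v : σ → ℝ}
    (hv : ∀ i, 0 ≤ v i) {τ₀ : ℝ} (h0 : aeval (fun i => x i + v i * τ₀) q ≠ 0) {τ : ℂ}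
    (hτ : 0 < τ.im) : aeval (fun i => (x i : ℂ) + v i * τ) q ≠ 0 := by
  -- With base point `x + v Re τ` and direction `v Im τ`, the parameter `I` gives `x + v τ` and the
  -- parameter `s` gives `x + v τ₀`.
  set s : ℝ := (τ₀ - τ.re) / τ.im with hs
  have hlim : |aeval (fun i => x i + v i * τ₀) q| ≤
      (1 + |s|) ^ q.totalDegree * ‖aeval (fun i => (x i : ℂ) + v i * τ) q‖ := by
    have h : ∀ η : ℝ, 0 < η →
        |aeval (fun i => (x i + (v i + η) * τ.re) + ((v i + η) * τ.im) * s) q| ≤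
        (1 + |s|) ^ q.totalDegree *
          ‖aeval (fun i => ((x i + (v i + η) * τ.re : ℝ) : ℂ) +
            ((v i + η) * τ.im : ℝ) * Complex.I) q‖ := fun η hη =>
      hq.norm_aeval_le (fun i => mul_pos (by linarith [hv i]) hτ) s le_rfl
    have c1 : Continuous fun η : ℝ =>
        |aeval (fun i => (x i + (v i + η) * τ.re) + ((v i + η) * τ.im) * s) q| :=
      (continuous_aeval' q (by fun_prop)).abs
    have c2 : Continuous fun η : ℝ => (1 + |s|) ^ q.totalDegree *
          ‖aeval (fun i => ((x i + (v i + η) * τ.re : ℝ) : ℂ) +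
            ((v i + η) * τ.im : ℝ) * Complex.I) q‖ :=
      continuous_const.mul (continuous_aeval' q (by fun_prop)).norm
    have := le_of_tendsto_of_tendsto
      (c1.continuousWithinAt (s := Set.Ioi 0) (x := 0))
      (c2.continuousWithinAt (s := Set.Ioi 0) (x := 0))
      (eventually_nhdsWithin_of_forall h)
    have e1 : (fun i => (x i + (v i + 0) * τ.re) + ((v i + 0) * τ.im) * s) =
        fun i => x i + v i * τ₀ := by
      funext i
      rw [hs]
      field_simp
      ring
    have e2 : (fun i => ((x i + (v i + 0) * τ.re : ℝ) : ℂ) +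
        ((v i + 0) * τ.im : ℝ) * Complex.I) = fun i => (x i : ℂ) + v i * τ := by
      funext i
      conv_rhs => rw [← Complex.re_add_im τ]
      push_cast
      ring
    simpa only [e1, e2] using this
  intro h
  rw [h, norm_zero, mul_zero] at hlim
  exact h0 (abs_nonpos_iff.1 hlim)

theorem Stable.splits_line {q : MvPolynomial σ ℝ} (hq : Stable q) {x v : σ → ℝ}
    (hv : ∀ i, 0 ≤ v i) {τ₀ : ℝ} (h0 : aeval (fun i => x i + v i * τ₀) q ≠ 0) :
    (line q x v).Splits := by
  refine Polynomial.Splits.of_splits_map (algebraMap ℝ ℂ) (IsAlgClosed.splits _) ?_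
  intro r hr
  have hr' := Polynomial.isRoot_of_mem_roots hr
  rw [Polynomial.IsRoot, map_line, eval_line] at hr'
  have him : r.im = 0 := by
    rcases lt_trichotomy r.im 0 with h | h | h
    · exfalso
      refine hq.aeval_line_ne_zero hv h0 (τ := conj r) (by simpa using h) ?_
      have := congrArg conj hr'
      rw [conj_aeval] at this
      simpa using this
    · exact h
    · exact absurd hr' (hq.aeval_line_ne_zero hv h0 h)
  exact ⟨r.re, by apply Complex.ext <;> simp [him]⟩

end KadisonSinger


/-! ### Logarithmic derivatives of stable polynomials. -/

namespace KadisonSinger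

open MvPolynomial Filter Topology ComplexConjugate

/-- If `N / D` maps the part of the upper half plane above `a` to the lower half plane, then
its derivative at `a` is nonpositive. -/
theorem derivative_mul_le_of_im_nonpos (N D : Polynomial ℝ) (a : ℝ)
    (h : ∀ ε : ℝ, 0 < ε → (Polynomial.aeval ((a : ℂ) + ε * Complex.I) N *
      conj (Polynomial.aeval ((a : ℂ) + ε * Complex.I) D)).im ≤ 0) :
    N.derivative.eval a * D.eval a ≤ N.eval a * D.derivative.eval a := by
  have hd : ∀ P : Polynomial ℝ,
      HasDerivAt (fun ε : ℝ => Polynomial.aeval ((a : ℂ) + ε * Complex.I) P)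
        ((P.derivative.eval a : ℝ) * Complex.I) 0 := by
    intro P
    have h1 : HasDerivAt (fun ε : ℝ => (a : ℂ) + ε * Complex.I) Complex.I 0 := by
      have := (((hasDerivAt_id (0 : ℝ)).ofReal_comp).mul_const Complex.I).const_add (a : ℂ)
      simpa using this
    have h2 := (P.map (algebraMap ℝ ℂ)).hasDerivAt ((a : ℂ) + (0 : ℝ) * Complex.I)
    have h3 := HasDerivAt.comp (0 : ℝ) h2 h1
    have e : (fun ε : ℝ => Polynomial.aeval ((a : ℂ) + ε * Complex.I) P) =
        (fun x => (P.map (algebraMap ℝ ℂ)).eval x) ∘ fun ε : ℝ => (a : ℂ) + ε * Complex.I := by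
      funext ε
      simp [Polynomial.eval_map_algebraMap]
    rw [e]
    refine h3.congr_deriv ?_
    rw [Complex.ofReal_zero, zero_mul, add_zero, Polynomial.derivative_map,
      Polynomial.eval_map_algebraMap, ← Complex.coe_algebraMap,
      Polynomial.aeval_algebraMap_apply, Polynomial.coe_aeval_eq_eval]
  have hval : ∀ P : Polynomial ℝ,
      Polynomial.aeval ((a : ℂ) + (0 : ℝ) * Complex.I) P = (P.eval a : ℝ) := by
    intro P
    simp only [Complex.ofReal_zero, zero_mul, add_zero]
    rw [← Complex.coe_algebraMap, Polynomial.aeval_algebraMap_apply]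
    simp
  have hc : HasDerivAt (fun ε : ℝ => conj (Polynomial.aeval ((a : ℂ) + ε * Complex.I) D))
      (conj ((D.derivative.eval a : ℝ) * Complex.I)) 0 :=
    (hd D).star
  have hp := (hd N).mul hc
  -- The product is real at `ε = 0`, so the first-order term of its imaginary part is the Wronskian
  -- `N'D - ND'`, whose sign is therefore determined.
  have him : HasDerivAt (fun ε : ℝ => (Polynomial.aeval ((a : ℂ) + ε * Complex.I) N *
      conj (Polynomial.aeval ((a : ℂ) + ε * Complex.I) D)).im)
      (N.derivative.eval a * D.eval a - N.eval a * D.derivative.eval a) 0 := by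
    have := (Complex.imCLM.hasFDerivAt.comp_hasDerivAt (0 : ℝ) hp)
    refine this.congr_deriv ?_
    simp only [hval, Complex.imCLM_apply]
    simp
    ring
  have hs := (hasDerivAt_iff_tendsto_slope_zero.1 him).mono_left
    (nhdsWithin_mono (0 : ℝ) (fun y hy => ne_of_gt hy : Set.Ioi (0 : ℝ) ⊆ {0}ᶜ))
  have hle := le_of_tendsto hs (b := 0) (by
    refine eventually_nhdsWithin_of_forall fun ε hε => ?_
    have hε' : 0 < ε := hε
    simp only [hval, zero_add, smul_eq_mul]
    have := h ε hε'
    have hz : (((N.eval a : ℝ) : ℂ) * conj ((D.eval a : ℝ) : ℂ)).im = 0 := by simp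
    rw [hz, sub_zero]
    exact mul_nonpos_of_nonneg_of_nonpos (inv_nonneg.2 hε'.le) this)
  linarith

variable {σ : Type*}

theorem derivative_line_single [Fintype σ] [DecidableEq σ] {K : Type*} [CommRing K] [Algebra ℝ K] (q : MvPolynomial σ ℝ)
    (z : σ → K) (j : σ) :
    Polynomial.derivative (line q z (Pi.single j 1)) = line (pderiv j q) z (Pi.single j 1) := by
  rw [derivative_line, Finset.sum_eq_single j]
  · simp
  · intro b _ hb
    simp [hb]
  · simp

theorem eval_line_zero {K : Type*} [CommRing K] [Algebra ℝ K] (q : MvPolynomial σ ℝ)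
    (z v : σ → K) : (line q z v).eval 0 = aeval z q := by
  rw [eval_line]; simp

theorem im_sum_inv_nonpos (s : Multiset ℂ) (hs : ∀ r ∈ s, r.im < 0) :
    ((s.map fun r => 1 / (0 - r)).sum).im ≤ 0 ∧
      (((s.map fun r => 1 / (0 - r)).sum).im = 0 → (s.map fun r => 1 / (0 - r)).sum = 0) := by
  induction s using Multiset.induction_on with
  | empty => simp
  | cons r s ih =>
    have ihs := (ih fun r' hr' => hs r' (Multiset.mem_cons_of_mem hr')).1
    have hr := hs r (Multiset.mem_cons_self r s)
    have h1 : (1 / (0 - r)).im < 0 := by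
      have h0 : 0 < Complex.normSq r := Complex.normSq_pos.2 fun h => by simp [h] at hr
      simp only [zero_sub, one_div, Complex.inv_im, Complex.neg_im, Complex.normSq_neg, neg_neg]
      exact div_neg_of_neg_of_pos hr h0
    rw [Multiset.map_cons, Multiset.sum_cons, Complex.add_im]
    exact ⟨by linarith, fun h => by linarith⟩

/-- The logarithmic derivatives of a stable polynomial map the upper half plane to the lower. -/
theorem Stable.im_logDeriv [Fintype σ] [DecidableEq σ] {q : MvPolynomial σ ℝ} (hq : Stable q) (i : σ) {z : σ → ℂ}
    (hz : ∀ i, 0 < (z i).im) :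
    (aeval z (pderiv i q) / aeval z q).im ≤ 0 ∧
      ((aeval z (pderiv i q) / aeval z q).im = 0 → aeval z (pderiv i q) / aeval z q = 0) := by
  set f := line q z (Pi.single i 1) with hf
  have hf0 : f.eval 0 = aeval z q := eval_line_zero _ _ _
  have hf1 : f.derivative.eval 0 = aeval z (pderiv i q) := by
    rw [hf, derivative_line_single, eval_line_zero]
  have hne : f.eval 0 ≠ 0 := hf0 ▸ hq z hz
  -- The logarithmic derivative is a sum of `1 / (0 - r)` over the roots in direction `i`. By
  -- stability these lie in the open lower half plane, so each term has negative imaginary part; a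
  -- vanishing imaginary part means that there are no roots.
  rw [← hf1, ← hf0, (IsAlgClosed.splits f).eval_derivative_div_eval_of_ne_zero hne]
  refine im_sum_inv_nonpos _ fun r hr => ?_
  have hr' := Polynomial.isRoot_of_mem_roots hr
  rw [Polynomial.IsRoot, hf, eval_line] at hr'
  by_contra hc
  refine hq _ (fun l => ?_) hr'
  by_cases h : l = i
  · subst h
    simp
    linarith [hz l, not_lt.1 hc]
  · simpa [h] using hz l

/-- Multiplying the logarithmic derivative by `|q|²` removes the denominator, so the sign passes to
the closed half planes, in particular to real points. -/
theorem Stable.im_mul_conj_nonpos [Fintype σ] [DecidableEq σ] {q : MvPolynomial σ ℝ} (hq : Stable q) (i : σ) {z : σ → ℂ}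
    (hz : ∀ i, 0 ≤ (z i).im) : (aeval z (pderiv i q) * conj (aeval z q)).im ≤ 0 := by
  have h : ∀ η : ℝ, 0 < η → (aeval (fun l => z l + η * Complex.I) (pderiv i q) *
      conj (aeval (fun l => z l + η * Complex.I) q)).im ≤ 0 := by
    intro η hη
    have hz' : ∀ l, 0 < (z l + η * Complex.I).im := fun l => by
      simp
      linarith [hz l]
    have h1 := (hq.im_logDeriv i hz').1
    set N := aeval (fun l => z l + η * Complex.I) (pderiv i q)
    set D := aeval (fun l => z l + η * Complex.I) q with hD
    have hD0 : D ≠ 0 := hq _ hz'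
    have : N * conj D = (N / D) * (Complex.normSq D : ℂ) := by
      rw [Complex.normSq_eq_conj_mul_self]
      field_simp
    rw [this, Complex.im_mul_ofReal]
    exact mul_nonpos_of_nonpos_of_nonneg h1 (Complex.normSq_nonneg _)
  have c : Continuous fun η : ℝ => (aeval (fun l => z l + η * Complex.I) (pderiv i q) *
      conj (aeval (fun l => z l + η * Complex.I) q)).im :=
    Complex.continuous_im.comp ((continuous_aeval' _ (by fun_prop)).mul
      (Complex.continuous_conj.comp (continuous_aeval' _ (by fun_prop))))
  have := le_of_tendsto (c.continuousWithinAt (s := Set.Ioi 0) (x := 0))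
    (eventually_nhdsWithin_of_forall h)
  simpa using this

theorem aeval_line_complex (q : MvPolynomial σ ℝ) (x v : σ → ℝ) (t : ℂ) :
    Polynomial.aeval t (line q x v) = aeval (fun i => (x i : ℂ) + v i * t) q := by
  rw [← eval_line, ← map_line, Polynomial.eval_map_algebraMap]

theorem Stable.im_line_nonpos [Fintype σ] [DecidableEq σ] {q : MvPolynomial σ ℝ} (hq : Stable q) (i j : σ) (x : σ → ℝ)
    {t : ℂ} (ht : 0 ≤ t.im) :
    (Polynomial.aeval t (line (pderiv i q) x (Pi.single j 1)) *
      conj (Polynomial.aeval t (line q x (Pi.single j 1)))).im ≤ 0 := by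
  rw [aeval_line_complex, aeval_line_complex]
  refine hq.im_mul_conj_nonpos i fun l => ?_
  by_cases h : l = j
  · subst h; simpa using ht
  · simp [h]

/-- The strong Rayleigh inequality: to first order off the real axis in direction `j`, `∂ᵢq / q`
moves into the lower half plane. -/
theorem Stable.mul_pderiv_pderiv_le [Fintype σ] [DecidableEq σ] {q : MvPolynomial σ ℝ} (hq : Stable q) (i j : σ)
    (x : σ → ℝ) :
    aeval x (pderiv j (pderiv i q)) * aeval x q ≤ aeval x (pderiv i q) * aeval x (pderiv j q) := by
  have := derivative_mul_le_of_im_nonpos (line (pderiv i q) x (Pi.single j 1))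
    (line q x (Pi.single j 1)) 0 fun ε hε => hq.im_line_nonpos i j x (by simpa using hε.le)
  simpa only [derivative_line_single, eval_line_zero] using this

/-- A quotient of polynomials with nonpositive partial derivatives is antitone. -/
theorem div_le_div_of_pderiv_mul_le [Fintype σ] [DecidableEq σ] {N D : MvPolynomial σ ℝ} {w : σ → ℝ} (hD : Above D w)
    (h : ∀ x, w ≤ x → ∀ i, aeval x (pderiv i N) * aeval x D ≤ aeval x N * aeval x (pderiv i D))
    {x y : σ → ℝ} (hx : w ≤ x) (hxy : x ≤ y) :
    aeval y N / aeval y D ≤ aeval x N / aeval x D := by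
  set v : σ → ℝ := fun i => y i - x i with hv
  have hv0 : ∀ i, 0 ≤ v i := fun i => sub_nonneg.2 (hxy i)
  have hpt : ∀ t : ℝ, 0 ≤ t → w ≤ fun i => x i + v i * t := fun t ht i => by
    have := mul_nonneg (hv0 i) ht
    have := hx i
    simp only
    linarith
  have hpos : ∀ t : ℝ, 0 ≤ t → 0 < (line D x v).eval t := fun t ht => by
    rw [eval_line]; exact hD _ (hpt t ht)
  have hanti : AntitoneOn (fun t : ℝ => (line N x v).eval t / (line D x v).eval t)
      (Set.Ici 0) := by
    refine antitoneOn_of_deriv_nonpos (convex_Ici 0) ?_ ?_ ?_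
    · exact (Polynomial.continuous _).continuousOn.div (Polynomial.continuous _).continuousOn
        fun t ht => (hpos t ht).ne'
    · intro t ht
      rw [interior_Ici] at ht
      exact ((line N x v).differentiableAt.fun_div (line D x v).differentiableAt
        (hpos t (le_of_lt ht)).ne').differentiableWithinAt
    · intro t ht
      rw [interior_Ici] at ht
      have ht' : 0 ≤ t := le_of_lt ht
      have hd := ((line N x v).hasDerivAt t).div ((line D x v).hasDerivAt t) (hpos t ht').ne'
      have hd' := hd.deriv
      have e : (fun t : ℝ => (line N x v).eval t / (line D x v).eval t) =
        (fun t : ℝ => (line N x v).eval t) / fun t : ℝ => (line D x v).eval t := rfl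
      rw [e, hd']
      refine div_nonpos_of_nonpos_of_nonneg ?_ (sq_nonneg _)
      rw [derivative_line, derivative_line, Polynomial.eval_finsetSum,
        Polynomial.eval_finsetSum, Finset.sum_mul, Finset.mul_sum, ← Finset.sum_sub_distrib]
      refine Finset.sum_nonpos fun i _ => ?_
      simp only [Polynomial.eval_mul, Polynomial.eval_C, eval_line]
      have := mul_le_mul_of_nonneg_left (h _ (hpt t ht') i) (hv0 i)
      linarith
  have := hanti (Set.mem_Ici.2 le_rfl) (Set.mem_Ici.2 zero_le_one) zero_le_one
  simp only [eval_line_zero] at this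
  have e : (fun i => x i + v i * 1) = y := by
    funext i; simp [hv]
  simpa only [eval_line, e] using this

/-- The strong Rayleigh inequality says exactly that all partial derivatives of `∂ⱼq / q` are
nonpositive. This monotonicity makes the logarithmic derivatives usable as barrier functions. -/
theorem Stable.logDeriv_antitone [Fintype σ] [DecidableEq σ] {q : MvPolynomial σ ℝ} (hq : Stable q) {w : σ → ℝ}
    (hw : Above q w) (j : σ) {x y : σ → ℝ} (hx : w ≤ x) (hxy : x ≤ y) :
    aeval y (pderiv j q) / aeval y q ≤ aeval x (pderiv j q) / aeval x q :=
  div_le_div_of_pderiv_mul_le hw (fun x _ i => hq.mul_pderiv_pderiv_le j i x) hx hxy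

theorem le_add_single [DecidableEq σ] {w x : σ → ℝ} (hx : w ≤ x) (j : σ) {t : ℝ} (ht : 0 ≤ t) :
    w ≤ fun i => x i + (Pi.single j 1 : σ → ℝ) i * t := fun i => by
  have h1 : (0 : ℝ) ≤ (Pi.single j 1 : σ → ℝ) i := by
    by_cases h : i = j
    · subst h; simp
    · simp [h]
  have := mul_nonneg h1 ht
  have := hx i
  simp only
  linarith

/-- Above the roots, the restriction to a coordinate line is a product of linear factors with
negative roots. -/
theorem Stable.exists_line_eq [DecidableEq σ] {q : MvPolynomial σ ℝ} (hq : Stable q) {w : σ → ℝ}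
    (hw : Above q w) (j : σ) :
    ∃ (a : ℝ) (n : ℕ) (y : Fin n → ℝ), 0 < a ∧ (∀ m, 0 < y m) ∧
      line q w (Pi.single j 1) =
        Polynomial.C a * ∏ m, (Polynomial.X + Polynomial.C (y m)) := by
  set f := line q w (Pi.single j 1) with hf
  have hs : f.Splits := hq.splits_line (τ₀ := 0)
    (fun i => by by_cases h : i = j
                 · subst h; simp
                 · simp [h]) (by simpa using (hw w le_rfl).ne')
  have hpos : ∀ t : ℝ, 0 ≤ t → 0 < f.eval t := fun t ht => by
    rw [hf, eval_line]; exact hw _ (le_add_single le_rfl j ht)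
  have hroot : ∀ r ∈ f.roots, r < 0 := fun r hr => by
    by_contra hc
    exact (hpos r (not_lt.1 hc)).ne' (Polynomial.isRoot_of_mem_roots hr)
  have hy : ∀ m : Fin f.roots.toList.length, 0 < -(f.roots.toList.get m) := fun m =>
    neg_pos.2 (hroot _ (Multiset.mem_toList.1 (List.get_mem _ _)))
  have heq : f = Polynomial.C f.leadingCoeff *
      ∏ m : Fin f.roots.toList.length,
        (Polynomial.X + Polynomial.C (-(f.roots.toList.get m))) := by
    conv_lhs => rw [hs.eq_prod_roots]
    congr 1
    conv_lhs => rw [← Multiset.coe_toList f.roots]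
    rw [Multiset.map_coe, Multiset.prod_coe, ← List.prod_ofFn]
    congr 1
    apply List.ext_get
    · simp
    · intro n h1 h2
      simp [sub_eq_add_neg]
  refine ⟨f.leadingCoeff, _, _, ?_, hy, heq⟩
  have h0 := hpos 0 le_rfl
  rw [heq, Polynomial.eval_mul, Polynomial.eval_prod, Polynomial.eval_C] at h0
  refine pos_of_mul_pos_left h0 (Finset.prod_nonneg fun m _ => ?_)
  simpa using (hy m).le

end KadisonSinger


namespace KadisonSinger

open Filter Topology ComplexConjugate Polynomial

/-! ### Real-rooted polynomials with a common interlacer -/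

section Univariate

variable {ι : Type*}

/-- The monic polynomial with roots `-y m`, `m ∈ s`. -/
noncomputable def rootProd (s : Finset ι) (y : ι → ℝ) : ℝ[X] := ∏ m ∈ s, (X + C (y m))

theorem rootProd_erase [DecidableEq ι] {s : Finset ι} {m : ι} (hm : m ∈ s) (y : ι → ℝ) :
    rootProd s y = (X + C (y m)) * rootProd (s.erase m) y :=
  (Finset.mul_prod_erase s _ hm).symm

theorem rootProd_monic (s : Finset ι) (y : ι → ℝ) : (rootProd s y).Monic :=
  monic_prod_of_monic _ _ fun m _ => monic_X_add_C (y m)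

theorem natDegree_rootProd (s : Finset ι) (y : ι → ℝ) : (rootProd s y).natDegree = s.card := by
  rw [rootProd, natDegree_prod_of_monic _ _ fun m _ => monic_X_add_C (y m)]
  simp

theorem eval_rootProd_pos {s : Finset ι} {y : ι → ℝ} (hy : ∀ m ∈ s, 0 < y m) {t : ℝ}
    (ht : 0 ≤ t) : 0 < (rootProd s y).eval t := by
  rw [rootProd, eval_prod]
  refine Finset.prod_pos fun m hm => ?_
  have := hy m hm
  simp
  linarith

theorem eval_rootProd_derivative {s : Finset ι} {y : ι → ℝ} (hy : ∀ m ∈ s, 0 < y m) :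
    (rootProd s y).derivative.eval 0 = (rootProd s y).eval 0 * ∑ m ∈ s, (y m)⁻¹ ∧
    (rootProd s y).derivative.derivative.eval 0 = (rootProd s y).eval 0 *
      ((∑ m ∈ s, (y m)⁻¹) ^ 2 - ∑ m ∈ s, (y m)⁻¹ ^ 2) := by
  classical
  induction s using Finset.induction_on with
  | empty => simp [rootProd]
  | insert m s hm ih =>
    obtain ⟨h1, h2⟩ := ih fun l hl => hy l (Finset.mem_insert_of_mem hl)
    have hym := hy m (Finset.mem_insert_self m s)
    have e : rootProd (insert m s) y = (X + C (y m)) * rootProd s y :=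
      Finset.prod_insert hm
    rw [e, Finset.sum_insert hm, Finset.sum_insert hm]
    simp only [derivative_mul, derivative_add, derivative_X, derivative_C, add_zero, one_mul,
      eval_add, eval_mul, eval_X, eval_C, zero_add, h1, h2]
    constructor
    · field_simp
    · field_simp
      ring

/-- Near a pole of order at least 2 the argument of the function sweeps both half planes; these two
directions detect it. -/
theorem exists_pow_eq_I {e : ℕ} (he : 2 ≤ e) :
    (∃ ω : ℂ, 0 < ω.im ∧ ω ^ e = Complex.I) ∧ ∃ ω : ℂ, 0 < ω.im ∧ ω ^ e = -Complex.I := by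
  have he' : (2 : ℝ) ≤ e := by exact_mod_cast he
  have he0 : (e : ℂ) ≠ 0 := by
    have : e ≠ 0 := by omega
    exact_mod_cast this
  have hpi := Real.pi_pos
  have him : ∀ θ : ℝ, (Complex.exp (θ * Complex.I)).im = Real.sin θ := fun θ =>
    Complex.exp_ofReal_mul_I_im θ
  constructor
  · refine ⟨Complex.exp ((Real.pi / 2 / e : ℝ) * Complex.I), ?_, ?_⟩
    · rw [him]
      apply Real.sin_pos_of_pos_of_lt_pi (by positivity)
      rw [div_lt_iff₀ (by linarith)]
      nlinarith
    · rw [← Complex.exp_nat_mul]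
      have : (e : ℂ) * ((Real.pi / 2 / e : ℝ) * Complex.I) = Real.pi / 2 * Complex.I := by
        push_cast
        field_simp
      rw [this, Complex.exp_pi_div_two_mul_I]
  · refine ⟨Complex.exp ((3 * Real.pi / 2 / e : ℝ) * Complex.I), ?_, ?_⟩
    · rw [him]
      apply Real.sin_pos_of_pos_of_lt_pi (by positivity)
      rw [div_lt_iff₀ (by linarith)]
      nlinarith
    · rw [← Complex.exp_nat_mul]
      have : (e : ℂ) * ((3 * Real.pi / 2 / e : ℝ) * Complex.I) =
          Real.pi * Complex.I + Real.pi / 2 * Complex.I := by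
        push_cast
        field_simp
        ring
      rw [this, Complex.exp_add, Complex.exp_pi_mul_I, Complex.exp_pi_div_two_mul_I]
      ring

theorem aeval_ofReal_complex (P : ℝ[X]) (r : ℝ) : aeval (r : ℂ) P = (P.eval r : ℝ) := by
  rw [← Complex.coe_algebraMap, aeval_algebraMap_apply, coe_aeval_eq_eval]

/-- If `g / f` maps the upper half plane to the lower half plane, its poles are simple. -/
theorem rootMultiplicity_le_one_of_im_nonpos {f g : ℝ[X]} (hf : f ≠ 0)
    (him : ∀ t : ℂ, 0 < t.im → (aeval t g * conj (aeval t f)).im ≤ 0) {r : ℝ}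
    (hr : g.eval r ≠ 0) : f.rootMultiplicity r ≤ 1 := by
  by_contra! he
  obtain ⟨h, hfh, hndvd⟩ := exists_eq_pow_rootMultiplicity_mul_and_not_dvd f hf r
  set e := f.rootMultiplicity r
  have hh : h.eval r ≠ 0 := fun h0 => hndvd (dvd_iff_isRoot.2 h0)
  have key : ∀ ω : ℂ, 0 < ω.im →
      (((g.eval r * h.eval r : ℝ) : ℂ) * conj (ω ^ e)).im ≤ 0 := by
    intro ω hω
    have c : Continuous fun ε : ℝ => (aeval ((r : ℂ) + ε * ω) g *
        conj (ω ^ e * aeval ((r : ℂ) + ε * ω) h)).im := by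
      have hc : ∀ P : ℝ[X], Continuous fun ε : ℝ => aeval ((r : ℂ) + ε * ω) P := fun P =>
        (Polynomial.continuous_aeval P).comp (by fun_prop)
      exact Complex.continuous_im.comp ((hc g).mul
        (Complex.continuous_conj.comp (continuous_const.mul (hc h))))
    have hle : ∀ ε : ℝ, 0 < ε → (aeval ((r : ℂ) + ε * ω) g *
        conj (ω ^ e * aeval ((r : ℂ) + ε * ω) h)).im ≤ 0 := by
      intro ε hε
      have h1 := him ((r : ℂ) + ε * ω) (by simpa using mul_pos hε hω)
      have h2 : aeval ((r : ℂ) + ε * ω) f =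
          ((ε ^ e : ℝ) : ℂ) * (ω ^ e * aeval ((r : ℂ) + ε * ω) h) := by
        rw [hfh]
        simp
        ring
      rw [h2, map_mul, Complex.conj_ofReal, mul_left_comm, Complex.im_ofReal_mul] at h1
      exact nonpos_of_mul_nonpos_right h1 (pow_pos hε e)
    have := le_of_tendsto (c.continuousWithinAt (s := Set.Ioi 0) (x := 0))
      (eventually_nhdsWithin_of_forall hle)
    simp only [Complex.ofReal_zero, zero_mul, add_zero, aeval_ofReal_complex, map_mul,
      Complex.conj_ofReal] at this
    push_cast
    rw [map_pow] at this ⊢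
    rwa [mul_assoc, mul_comm _ (conj ω ^ e)]
  -- The leading term of `g * conj f` near `r` is a real nonzero multiple of `conj (ω ^ e)`. It
  -- cannot be nonpositive in imaginary part for both `ω ^ e = I` and `ω ^ e = -I`.
  obtain ⟨⟨ω, hω, hωe⟩, ω', hω', hωe'⟩ := exists_pow_eq_I he
  have h1 := key ω hω
  have h2 := key ω' hω'
  rw [hωe, Complex.im_ofReal_mul] at h1
  rw [hωe', Complex.im_ofReal_mul] at h2
  simp at h1 h2
  exact mul_ne_zero hr hh (le_antisymm h2 h1)

/-- A polynomial `g` such that `g / f` maps the upper half plane to the lower half plane is a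
combination of `f` and the `f / (X - r)`, `r` a root of `f`, with nonnegative coefficients for
the latter. -/
theorem exists_eq_sum_of_im_nonpos [DecidableEq ι] (y : ι → ℝ) (n : ℕ) :
    ∀ (s : Finset ι) (g : ℝ[X]), s.card = n → g.natDegree ≤ s.card →
    (∀ t : ℂ, 0 < t.im → (aeval t g * conj (aeval t (rootProd s y))).im ≤ 0) →
    ∃ (α : ℝ) (c : ι → ℝ), (∀ m ∈ s, 0 ≤ c m) ∧
      g = C α * rootProd s y + ∑ m ∈ s, C (c m) * rootProd (s.erase m) y := by
  induction n with
  | zero =>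
    intro s g hs hg _
    rw [Finset.card_eq_zero] at hs
    subst hs
    refine ⟨g.coeff 0, 0, by simp, ?_⟩
    simpa [rootProd] using eq_C_of_natDegree_le_zero hg
  | succ n ih =>
    intro s g hs hg him
    -- Partial fractions of `g / f`. A common root is cancelled, which changes `g * conj f` only by
    -- a positive factor, and induction applies. Without common roots all poles are simple.
    by_cases hroot : ∃ m ∈ s, g.eval (-y m) = 0
    · obtain ⟨m, hm, hgm⟩ := hroot
      obtain ⟨g₁, rfl⟩ : (X + C (y m)) ∣ g := by
        have := dvd_iff_isRoot.2 hgm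
        simpa using this
      have hcard : (s.erase m).card = n := by rw [Finset.card_erase_of_mem hm, hs]; rfl
      obtain ⟨α, c, hc, h⟩ := ih (s.erase m) g₁ hcard (by
          by_cases h0 : g₁ = 0
          · simp [h0]
          · rw [(monic_X_add_C (y m)).natDegree_mul' h0, natDegree_X_add_C] at hg
            omega)
        (fun t ht => by
          have h1 := him t ht
          rw [rootProd_erase hm] at h1
          simp only [map_mul] at h1
          set u := aeval t (X + C (y m)) with hu
          have hu0 : u ≠ 0 := fun h0 => by
            have : u.im = t.im := by simp [hu]
            rw [h0] at this
            simp at this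
            linarith
          have e : u * aeval t g₁ * (conj u * conj (aeval t (rootProd (s.erase m) y))) =
              (Complex.normSq u : ℂ) *
                (aeval t g₁ * conj (aeval t (rootProd (s.erase m) y))) := by
            rw [Complex.normSq_eq_conj_mul_self]; ring
          rw [e, Complex.im_ofReal_mul] at h1
          exact nonpos_of_mul_nonpos_right h1 (Complex.normSq_pos.2 hu0))
      refine ⟨α, Function.update c m 0, fun l hl => ?_, ?_⟩
      · by_cases hlm : l = m
        · simp [hlm]
        · rw [Function.update_of_ne hlm]
          exact hc l (Finset.mem_erase.2 ⟨hlm, hl⟩)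
      · rw [← Finset.add_sum_erase s _ hm]
        simp only [Function.update_self, map_zero, zero_mul, zero_add]
        nth_rewrite 1 [h]
        rw [mul_add, Finset.mul_sum, rootProd_erase hm]
        congr 1
        · ring
        · refine Finset.sum_congr rfl fun l hl => ?_
          have hlm := (Finset.mem_erase.1 hl).1
          rw [Function.update_of_ne hlm, Finset.erase_right_comm,
            rootProd_erase (s := s.erase l) (m := m)
              (Finset.mem_erase.2 ⟨hlm.symm, hm⟩)]
          ring
    · push Not at hroot
      have hinj : Set.InjOn (fun m => -y m) s := by
        intro m hm l hl hml
        by_contra hne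
        have hml' : y m = y l := neg_injective hml
        have h1 := rootMultiplicity_le_one_of_im_nonpos (rootProd_monic s y).ne_zero him
          (hroot m hm)
        have hdvd : (X - C (-y m)) ^ 2 ∣ rootProd s y := by
          rw [rootProd_erase hm, rootProd_erase (s := s.erase m) (m := l)
            (Finset.mem_erase.2 ⟨fun h => hne h.symm, hl⟩), ← hml']
          refine ⟨rootProd ((s.erase m).erase l) y, ?_⟩
          simp
          ring
        have h2 := (le_rootMultiplicity_iff (rootProd_monic s y).ne_zero).2 hdvd
        omega
      have hev : ∀ m ∈ s, (rootProd s y).eval (-y m) = 0 := fun m hm => by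
        rw [rootProd_erase hm]; simp
      have hne : ∀ m ∈ s, (rootProd (s.erase m) y).eval (-y m) ≠ 0 := fun m hm => by
        rw [rootProd, eval_prod]
        refine Finset.prod_ne_zero_iff.2 fun l hl => ?_
        have hl' := Finset.mem_erase.1 hl
        simp only [eval_add, eval_X, eval_C]
        intro h0
        exact hl'.1 (hinj hl'.2 hm (by simp only; linarith))
      have hev' : ∀ m ∈ s, ∀ l ∈ s, l ≠ m → (rootProd (s.erase m) y).eval (-y l) = 0 :=
        fun m hm l hl hlm => by
          rw [rootProd_erase (s := s.erase m) (m := l) (Finset.mem_erase.2 ⟨hlm, hl⟩)]; simp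
      -- `α` is the value at infinity and the `c m` are the residues, nonnegative by the Wronskian
      -- inequality at `-y m`. The identity is Lagrange interpolation: after subtracting `α f` both
      -- sides have degree below the number of nodes and agree at each node.
      refine ⟨g.coeff s.card, fun m => g.eval (-y m) / (rootProd (s.erase m) y).eval (-y m),
        fun m hm => ?_, ?_⟩
      · have h1 := derivative_mul_le_of_im_nonpos g (rootProd s y) (-y m) fun ε hε =>
          him _ (by simpa using hε)
        rw [hev m hm, mul_zero, rootProd_erase hm] at h1
        simp at h1
        exact div_nonneg_iff.2 (mul_nonneg_iff.1 h1)
      · rw [← sub_eq_iff_eq_add']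
        refine eq_of_degrees_lt_of_eval_index_eq s hinj ?_ ?_ ?_
        · rw [degree_lt_iff_coeff_zero]
          intro k hk
          have hd := natDegree_rootProd s y
          rcases hk.eq_or_lt with rfl | hk
          · rw [coeff_sub, coeff_C_mul]
            nth_rewrite 3 [← hd]
            rw [(rootProd_monic s y).coeff_natDegree, mul_one, sub_self]
          · rw [coeff_sub, coeff_C_mul, coeff_eq_zero_of_natDegree_lt (hg.trans_lt hk),
              coeff_eq_zero_of_natDegree_lt (hd.trans_lt hk), mul_zero, sub_zero]
        · refine (degree_sum_le _ _).trans_lt ?_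
          rw [Finset.sup_lt_iff (by exact WithBot.bot_lt_coe _)]
          intro m hm
          refine (degree_mul_le _ _).trans_lt
            ((add_le_add_left degree_C_le _).trans_lt ?_)
          rw [zero_add, degree_eq_natDegree (rootProd_monic _ _).ne_zero, natDegree_rootProd]
          exact_mod_cast Finset.card_erase_lt_of_mem hm
        · intro l hl
          rw [eval_sub, eval_mul, hev l hl, mul_zero, sub_zero, eval_finsetSum,
            Finset.sum_eq_single l]
          · rw [eval_mul, eval_C, div_mul_cancel₀ _ (hne l hl)]
          · intro m hm hml
            rw [eval_mul, hev' m hm l hl hml.symm, mul_zero]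
          · exact fun h => absurd hl h

/-- The inequality is linear in `g`, so partial fractions reduce it to `g = f`, where it is an
equality, and to `g = f / (X + y m) = h`, where it amounts to `δ h'(0) ≤ h(0)`. This univariate
statement says that the barriers do not increase in `barrier_step`. -/
theorem derivative_mul_le_mul_derivative [DecidableEq ι] {s : Finset ι} {y : ι → ℝ}
    (hy : ∀ m ∈ s, 0 < y m) {g : ℝ[X]} (hg : g.natDegree ≤ s.card)
    (him : ∀ t : ℂ, 0 < t.im → (aeval t g * conj (aeval t (rootProd s y))).im ≤ 0)
    {δ : ℝ} (hδ : 0 ≤ δ)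
    (hδf : δ * (rootProd s y).derivative.eval 0 ≤ (rootProd s y).eval 0) :
    g.derivative.eval 0 * (rootProd s y).eval δ ≤
      g.eval δ * (rootProd s y).derivative.eval 0 := by
  obtain ⟨α, c, hc, rfl⟩ := exists_eq_sum_of_im_nonpos y s.card s g rfl hg him
  have key : ∀ m ∈ s, (rootProd (s.erase m) y).derivative.eval 0 * (rootProd s y).eval δ ≤
      (rootProd (s.erase m) y).eval δ * (rootProd s y).derivative.eval 0 := by
    intro m hm
    have hye : ∀ l ∈ s.erase m, 0 < y l := fun l hl => hy l (Finset.mem_of_mem_erase hl)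
    have hm0 := hy m hm
    have p0 := eval_rootProd_pos hye le_rfl
    have pδ := eval_rootProd_pos hye hδ
    rw [rootProd_erase hm] at hδf ⊢
    simp only [derivative_mul, derivative_add, derivative_X, derivative_C, add_zero, one_mul,
      eval_add, eval_mul, eval_X, eval_C, zero_add] at hδf ⊢
    set a := (rootProd (s.erase m) y).eval 0
    set b := (rootProd (s.erase m) y).derivative.eval 0
    set d := (rootProd (s.erase m) y).eval δ
    have h1 : δ * b ≤ a := by
      have : y m * (δ * b) ≤ y m * a := by nlinarith
      exact le_of_mul_le_mul_left this hm0
    nlinarith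
  simp only [derivative_add, derivative_sum, derivative_mul, derivative_C, zero_mul, zero_add,
    eval_add, eval_mul, eval_C, eval_finsetSum, add_mul, Finset.sum_mul]
  refine add_le_add (le_of_eq (by ring)) (Finset.sum_le_sum fun m hm => ?_)
  have := mul_le_mul_of_nonneg_left (key m hm) (hc m hm)
  linarith

end Univariate

end KadisonSinger


namespace KadisonSinger

open MvPolynomial Filter Topology ComplexConjugate

/-! ### Derivatives of stable polynomials and the barrier argument -/

theorem pderiv_pderiv_comm {σ R : Type*} [CommRing R] (i j : σ) (q : MvPolynomial σ R) :
    pderiv i (pderiv j q) = pderiv j (pderiv i q) := by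
  classical
  have h : ⁅(pderiv i : Derivation R (MvPolynomial σ R) (MvPolynomial σ R)),
      (pderiv j : Derivation R (MvPolynomial σ R) (MvPolynomial σ R))⁆ = 0 := by
    refine derivation_ext fun l => ?_
    have h1 : ∀ i j : σ, pderiv i (pderiv j (X l : MvPolynomial σ R)) = 0 := fun i j => by
      by_cases hl : l = j
      · subst hl; simp
      · rw [pderiv_X_of_ne hl, map_zero]
    rw [Derivation.commutator_apply, h1, h1, sub_zero]
    rfl
  have := DFunLike.congr_fun h q
  rw [Derivation.commutator_apply] at this
  exact sub_eq_zero.1 this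

section Barrier

variable {σ : Type*} [DecidableEq σ]

theorem line_sub_single (q : MvPolynomial σ ℝ) (z : σ → ℝ) (j : σ) (δ a : ℝ) {n : ℕ}
    (y : Fin n → ℝ)
    (h : line q z (Pi.single j 1) = Polynomial.C a * rootProd Finset.univ y) :
    line q (z - Pi.single j δ) (Pi.single j 1) =
      Polynomial.C a * rootProd Finset.univ fun m => y m - δ := by
  refine Polynomial.funext fun t => ?_
  have h1 : (line q (z - Pi.single j δ) (Pi.single j 1)).eval t =
      (line q z (Pi.single j 1)).eval (t - δ) := by
    rw [eval_line, eval_line]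
    congr 2
    funext i
    by_cases hi : i = j
    · subst hi; simp; ring
    · simp [hi]
  rw [h1, h]
  simp only [rootProd, Polynomial.eval_mul, Polynomial.eval_C, Polynomial.eval_prod,
    Polynomial.eval_add, Polynomial.eval_X]
  congr 1
  exact Finset.prod_congr rfl fun m _ => by ring

variable [Fintype σ]

theorem Stable.exists_line_eq_rootProd {q : MvPolynomial σ ℝ} (hq : Stable q) {w : σ → ℝ}
    (hw : Above q w) (j : σ) :
    ∃ (a : ℝ) (n : ℕ) (y : Fin n → ℝ), 0 < a ∧ (∀ m, 0 < y m) ∧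
      line q w (Pi.single j 1) = Polynomial.C a * rootProd Finset.univ y ∧
      aeval w q = a * (rootProd Finset.univ y).eval 0 ∧
      aeval w (pderiv j q) = aeval w q * ∑ m, (y m)⁻¹ ∧
      aeval w (pderiv j (pderiv j q)) =
        aeval w q * ((∑ m, (y m)⁻¹) ^ 2 - ∑ m, (y m)⁻¹ ^ 2) := by
  obtain ⟨a, n, y, ha, hy, h⟩ := hq.exists_line_eq hw j
  obtain ⟨h1, h2⟩ := eval_rootProd_derivative (s := Finset.univ) (y := y) fun m _ => hy m
  have e0 : aeval w q = a * (rootProd Finset.univ y).eval 0 := by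
    rw [← eval_line_zero q w (Pi.single j 1), h]
    simp [rootProd]
  have e1 := congrArg Polynomial.derivative h
  have e2 := congrArg Polynomial.derivative e1
  rw [derivative_line_single] at e1
  rw [derivative_line_single, derivative_line_single] at e2
  replace e1 := congrArg (Polynomial.eval 0) e1
  replace e2 := congrArg (Polynomial.eval 0) e2
  rw [eval_line_zero] at e1 e2
  simp only [Polynomial.derivative_C_mul, Polynomial.eval_C_mul] at e1 e2
  refine ⟨a, n, y, ha, hy, h, e0, ?_, ?_⟩
  · rw [e1, e0]
    exact (congrArg (a * ·) h1).trans (by ring)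
  · rw [e2, e0]
    exact (congrArg (a * ·) h2).trans (by ring)

theorem Stable.pderiv_nonneg {q : MvPolynomial σ ℝ} (hq : Stable q) {w : σ → ℝ}
    (hw : Above q w) (j : σ) {x : σ → ℝ} (hx : w ≤ x) : 0 ≤ aeval x (pderiv j q) := by
  obtain ⟨a, n, y, ha, hy, h, h0, h1, -⟩ := hq.exists_line_eq_rootProd (hw.mono hx) j
  rw [h1]
  exact mul_nonneg (hw x hx).le (Finset.sum_nonneg fun m _ => (inv_pos.2 (hy m)).le)

theorem Above.pderiv {q : MvPolynomial σ ℝ} (hq : Stable q) {w : σ → ℝ} (hw : Above q w) {j : σ}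
    (hj : pderiv j q ≠ 0) : Above (pderiv j q) w := by
  intro x hx
  refine lt_of_le_of_ne (hq.pderiv_nonneg hw j hx) fun h0 => hj ?_
  -- If `∂ⱼq` vanishes at `x`, monotonicity squeezes `∂ⱼq / q` to 0 on the whole orthant above `x`,
  -- a product of infinite sets, so `∂ⱼq` is the zero polynomial.
  refine funext_set (fun i => Set.Ici (x i)) (fun i => Set.Ici_infinite _) fun y hy => ?_
  have hxy : x ≤ y := fun i => hy i (Set.mem_univ i)
  have h1 := hq.logDeriv_antitone hw j hx hxy
  rw [← h0, zero_div] at h1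
  have h2 := hw y (hx.trans hxy)
  have h3 : aeval y (MvPolynomial.pderiv j q) ≤ 0 := by
    rw [div_le_iff₀ h2, zero_mul] at h1
    exact h1
  have h4 := le_antisymm h3 (hq.pderiv_nonneg hw j (hx.trans hxy))
  rw [map_zero, ← h4]
  rfl

/-- The perturbations `ηq + ∂ⱼq` are stable, because `∂ⱼq / q` cannot take the negative real value
`-η`. As `η → 0` stability could only be lost by degeneration, which the bound of
`Stable.norm_aeval_le` excludes once `∂ⱼq` is known to be positive at some real point. -/
theorem Stable.pderiv {q : MvPolynomial σ ℝ} (hq : Stable q) {w : σ → ℝ} (hw : Above q w) {j : σ}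
    (hj : pderiv j q ≠ 0) : Stable (pderiv j q) := by
  have hst : ∀ η : ℝ, 0 < η → Stable (C η * q + MvPolynomial.pderiv j q) := by
    intro η hη z hz h0
    have hqz := hq z hz
    have h1 := hq.im_logDeriv j hz
    rw [map_add, map_mul, algHom_C] at h0
    have h2 : aeval z (MvPolynomial.pderiv j q) / aeval z q = -(η : ℂ) := by
      rw [div_eq_iff hqz, eq_neg_of_add_eq_zero_right h0]
      simp
    rw [h2] at h1
    have := h1.2 (by simp)
    simp at this
    exact hη.ne' this
  intro z hz h0
  have hb : BddAbove (Set.range fun i => (w i - (z i).re) / (z i).im) :=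
    Set.finite_range _ |>.bddAbove
  -- `τ` is so large that the real point `Re z + τ Im z` lies above `w`; there `∂ⱼq` is positive.
  obtain ⟨τ, hτ⟩ := hb
  have hpt : w ≤ fun i => (z i).re + (z i).im * τ := fun i => by
    have h1 : (w i - (z i).re) / (z i).im ≤ τ := hτ ⟨i, rfl⟩
    rw [div_le_iff₀ (hz i)] at h1
    simp only
    linarith
  have hzi : (fun i => ((z i).re : ℂ) + (z i).im * Complex.I) = z :=
    funext fun i => Complex.re_add_im (z i)
  set n := max q.totalDegree (MvPolynomial.pderiv j q).totalDegree with hn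
  have hle : ∀ η : ℝ, 0 < η →
      |aeval (fun i => (z i).re + (z i).im * τ) (C η * q + MvPolynomial.pderiv j q)| ≤
        (1 + |τ|) ^ n * ‖aeval z (C η * q + MvPolynomial.pderiv j q)‖ := by
    intro η hη
    have := (hst η hη).norm_aeval_le (x := fun i => (z i).re) hz τ (n := n) (by
      refine (totalDegree_add _ _).trans (max_le_max ?_ le_rfl)
      refine (totalDegree_mul _ _).trans ?_
      simp)
    rwa [hzi] at this
  have e1 : ∀ η : ℝ, aeval (fun i => (z i).re + (z i).im * τ)
      (C η * q + MvPolynomial.pderiv j q) =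
      η * aeval (fun i => (z i).re + (z i).im * τ) q +
        aeval (fun i => (z i).re + (z i).im * τ) (MvPolynomial.pderiv j q) := fun η => by
    rw [map_add, map_mul, algHom_C]; rfl
  have e2 : ∀ η : ℝ, aeval z (C η * q + MvPolynomial.pderiv j q) = η * aeval z q := fun η => by
    rw [map_add, map_mul, algHom_C, h0, add_zero]; rfl
  simp only [e1, e2] at hle
  have c1 : Continuous fun η : ℝ => |η * aeval (fun i => (z i).re + (z i).im * τ) q +
        aeval (fun i => (z i).re + (z i).im * τ) (MvPolynomial.pderiv j q)| := by fun_prop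
  have c2 : Continuous fun η : ℝ => (1 + |τ|) ^ n * ‖(η : ℂ) * aeval z q‖ := by fun_prop
  have := le_of_tendsto_of_tendsto
    (c1.continuousWithinAt (s := Set.Ioi 0) (x := 0))
    (c2.continuousWithinAt (s := Set.Ioi 0) (x := 0))
    (eventually_nhdsWithin_of_forall hle)
  simp only [zero_mul, zero_add, Complex.ofReal_zero, norm_zero, mul_zero] at this
  exact (hw.pderiv hq hj _ hpt).ne' (abs_nonpos_iff.1 this)

theorem natDegree_le_of_iterate_derivative_eq_zero {f : Polynomial ℝ} {e : ℕ}
    (h : Polynomial.derivative^[e + 1] f = 0) : f.natDegree ≤ e := by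
  refine Polynomial.natDegree_le_iff_coeff_eq_zero.2 fun k hk => ?_
  obtain ⟨l, rfl⟩ := Nat.exists_eq_add_of_le hk
  have := congrArg (fun P => Polynomial.coeff P l) h
  simp only [Polynomial.coeff_iterate_derivative, Polynomial.coeff_zero, nsmul_eq_mul,
    mul_eq_zero, Nat.cast_eq_zero] at this
  rcases this with h0 | h0
  · rw [Nat.descFactorial_eq_zero_iff_lt] at h0
    omega
  · rwa [add_comm]

theorem iterate_derivative_line (q : MvPolynomial σ ℝ) (x : σ → ℝ) (j : σ) (n : ℕ) :
    Polynomial.derivative^[n] (line q x (Pi.single j 1)) =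
      line ((MvPolynomial.pderiv j)^[n] q) x (Pi.single j 1) := by
  induction n with
  | zero => rfl
  | succ n ih => rw [Function.iterate_succ_apply', Function.iterate_succ_apply', ih,
      derivative_line_single]

/-- The restriction of `q` to the `j`-th coordinate line through a point `z` with
`c * ∂ⱼ q z ≤ q z`. -/
theorem Stable.exists_line_eq_of_barrier {q : MvPolynomial σ ℝ} (hq : Stable q) {z : σ → ℝ}
    (hz : Above q z) {j : σ} {c : ℝ} (hc : 0 < c)
    (hpot : c * aeval z (MvPolynomial.pderiv j q) ≤ aeval z q) :
    ∃ (a : ℝ) (n : ℕ) (y : Fin n → ℝ), 0 < a ∧ (∀ m, c ≤ y m) ∧ c * ∑ m, (y m)⁻¹ ≤ 1 ∧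
      line q z (Pi.single j 1) = Polynomial.C a * rootProd Finset.univ y := by
  obtain ⟨a, n, y, ha, hy, h, h0, h1, -⟩ := hq.exists_line_eq_rootProd hz j
  have hqz := hz z le_rfl
  have hsum : c * ∑ m, (y m)⁻¹ ≤ 1 := by
    rw [h1] at hpot
    have : aeval z q * (c * ∑ m, (y m)⁻¹) ≤ aeval z q * 1 := by linarith
    exact le_of_mul_le_mul_left this hqz
  refine ⟨a, n, y, ha, fun m => ?_, hsum, h⟩
  have h2 : (y m)⁻¹ ≤ ∑ m, (y m)⁻¹ :=
    Finset.single_le_sum (fun m _ => (inv_pos.2 (hy m)).le) (Finset.mem_univ m)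
  have h3 : c * (y m)⁻¹ ≤ 1 := (mul_le_mul_of_nonneg_left h2 hc.le).trans hsum
  rwa [← div_eq_mul_inv, div_le_one (hy m)] at h3

/-- A bound `1/c` on the logarithmic derivative keeps every root in direction `j` at distance at
least `c`. By monotonicity this holds at all points above `z`, so a shift by `c / 2` meets no zero.
-/
theorem Above.sub_single {q : MvPolynomial σ ℝ} (hq : Stable q) {z : σ → ℝ} (hz : Above q z)
    {j : σ} {c : ℝ} (hc : 0 < c)
    (hpot : c * aeval z (MvPolynomial.pderiv j q) ≤ aeval z q) :
    Above q (z - Pi.single j (c / 2)) := by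
  intro x hx
  have hx' : z ≤ x + Pi.single j (c / 2) := by
    rwa [sub_le_iff_le_add] at hx
  have hpot' : c * aeval (x + Pi.single j (c / 2)) (MvPolynomial.pderiv j q) ≤
      aeval (x + Pi.single j (c / 2)) q := by
    have h1 := hq.logDeriv_antitone hz j le_rfl hx'
    have h2 := hz z le_rfl
    have h3 := hz _ hx'
    rw [div_le_div_iff₀ h3 h2] at h1
    have : aeval z q * (c * aeval (x + Pi.single j (c / 2)) (MvPolynomial.pderiv j q)) ≤
        aeval z q * aeval (x + Pi.single j (c / 2)) q := by
      nlinarith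
    exact le_of_mul_le_mul_left this h2
  obtain ⟨a, n, y, ha, hy, -, h⟩ := hq.exists_line_eq_of_barrier (hz.mono hx') hc hpot'
  have h1 := line_sub_single q _ j (c / 2) a y h
  rw [add_sub_cancel_right] at h1
  rw [← eval_line_zero q x (Pi.single j 1), h1, Polynomial.eval_mul, Polynomial.eval_C]
  exact mul_pos ha (eval_rootProd_pos (fun m _ => by linarith [hy m]) le_rfl)

/-- If the degree were larger, `∂ᵢq / q` would be unbounded along the line, yet it is antitone and
nonnegative. -/
theorem Stable.natDegree_line_pderiv_le {q : MvPolynomial σ ℝ} (hq : Stable q) {w : σ → ℝ}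
    (hw : Above q w) (i j : σ) :
    (line (MvPolynomial.pderiv i q) w (Pi.single j 1)).natDegree ≤
      (line q w (Pi.single j 1)).natDegree := by
  set g := line (MvPolynomial.pderiv i q) w (Pi.single j 1) with hg
  set f := line q w (Pi.single j 1) with hf
  have hf0 : f ≠ 0 := fun h => by
    have := hw w le_rfl
    rw [← eval_line_zero q w (Pi.single j 1), ← hf, h] at this
    simp at this
  by_contra! hc
  have ht := Polynomial.abs_div_tendsto_atTop_atTop_of_degree_gt g f
    ((Polynomial.natDegree_lt_natDegree_iff hf0).1 hc) hf0
  obtain ⟨t, h1, h2⟩ := ((ht.eventually_gt_atTop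
    (aeval w (MvPolynomial.pderiv i q) / aeval w q)).and (eventually_ge_atTop 0)).exists
  have h3 := le_add_single (w := w) le_rfl j h2
  rw [hg, hf, eval_line, eval_line, abs_of_nonneg
    (div_nonneg (hq.pderiv_nonneg hw i h3) (hw _ h3).le)] at h1
  exact absurd (hq.logDeriv_antitone hw i le_rfl h3) (not_le.2 h1)

/-- Differentiating in direction `j` while moving down by half of the barrier value. -/
theorem barrier_step {q : MvPolynomial σ ℝ} (hq : Stable q) {z : σ → ℝ} (hz : Above q z)
    {j : σ} (hj : MvPolynomial.pderiv j q ≠ 0) {c : ℝ} (hc : 0 < c)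
    (hpot : c * aeval z (MvPolynomial.pderiv j q) ≤ aeval z q) :
    Stable (MvPolynomial.pderiv j q) ∧
    Above (MvPolynomial.pderiv j q) (z - Pi.single j (c / 2)) ∧
    (∀ (i : σ) (c' : ℝ), 0 ≤ c' → c' * aeval z (MvPolynomial.pderiv i q) ≤ aeval z q →
      c' * aeval (z - Pi.single j (c / 2)) (MvPolynomial.pderiv i (MvPolynomial.pderiv j q)) ≤
        aeval (z - Pi.single j (c / 2)) (MvPolynomial.pderiv j q)) ∧
    ∀ e : ℕ, (MvPolynomial.pderiv j)^[e + 1] q = 0 →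
      c * (2 * e - 1) * aeval (z - Pi.single j (c / 2))
        (MvPolynomial.pderiv j (MvPolynomial.pderiv j q)) ≤
        (2 * e - 2) * aeval (z - Pi.single j (c / 2)) (MvPolynomial.pderiv j q) := by
  set w := z - Pi.single j (c / 2) with hw
  have haw : Above q w := hz.sub_single hq hc hpot
  have hqw := haw w le_rfl
  have hqz := hz z le_rfl
  obtain ⟨a, n, x, ha, hx, hsum, h⟩ := hq.exists_line_eq_of_barrier hz hc hpot
  set y : Fin n → ℝ := fun m => x m - c / 2 with hy
  have hy0 : ∀ m, 0 < y m := fun m => by simp only [hy]; linarith [hx m]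
  have hl : line q w (Pi.single j 1) = Polynomial.C a * rootProd Finset.univ y :=
    line_sub_single q z j (c / 2) a x h
  obtain ⟨d1, d2⟩ := eval_rootProd_derivative (s := Finset.univ) (y := y) fun m _ => hy0 m
  set F := rootProd Finset.univ y with hF
  have hzw : (fun i => w i + (Pi.single j 1 : σ → ℝ) i * (c / 2)) = z := by
    funext i
    by_cases hi : i = j
    · subst hi; simp [hw]
    · simp [hw, hi]
  have v0 : aeval w q = a * F.eval 0 := by
    rw [← eval_line_zero q w (Pi.single j 1), hl]; simp
  have v1 : aeval w (MvPolynomial.pderiv j q) = a * F.derivative.eval 0 := by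
    rw [← eval_line_zero _ w (Pi.single j 1), ← derivative_line_single, hl]; simp
  have v2 : aeval w (MvPolynomial.pderiv j (MvPolynomial.pderiv j q)) =
      a * F.derivative.derivative.eval 0 := by
    rw [← eval_line_zero _ w (Pi.single j 1), ← derivative_line_single,
      ← derivative_line_single, hl]; simp
  have vz : aeval z q = a * F.eval (c / 2) := by
    conv_lhs => rw [← hzw]
    rw [← eval_line, hl]; simp
  have hF0 : 0 < F.eval 0 := eval_rootProd_pos (fun m _ => hy0 m) le_rfl
  have hyx : ∀ m, (y m)⁻¹ ≤ 2 * (x m)⁻¹ := fun m => by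
    have hxm : 0 < x m := by linarith [hx m]
    rw [inv_le_comm₀ (hy0 m) (by positivity), mul_inv, inv_inv]
    simp only [hy]
    linarith [hx m]
  -- Since `x m ≥ c`, the shifted root distance `y m` is at least half of `x m`. This supplies the
  -- hypothesis on `δ = c / 2` in `derivative_mul_le_mul_derivative`.
  have hΦ : c / 2 * ∑ m, (y m)⁻¹ ≤ 1 := by
    have : ∑ m, (y m)⁻¹ ≤ 2 * ∑ m, (x m)⁻¹ := by
      rw [Finset.mul_sum]; exact Finset.sum_le_sum fun m _ => hyx m
    nlinarith
  refine ⟨hq.pderiv hz hj, haw.pderiv hq hj, fun i c' hc' hpi => ?_, fun e he => ?_⟩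
  · set g := line (MvPolynomial.pderiv i q) w (Pi.single j 1) with hg
    have hdeg : g.natDegree ≤ (Finset.univ : Finset (Fin n)).card := by
      have := hq.natDegree_line_pderiv_le haw i j
      rw [hl, Polynomial.natDegree_C_mul ha.ne', hF, natDegree_rootProd] at this
      exact this
    have him : ∀ t : ℂ, 0 < t.im →
        (Polynomial.aeval t g * conj (Polynomial.aeval t F)).im ≤ 0 := by
      intro t ht
      have h1 := hq.im_line_nonpos i j w ht.le
      rw [hl, map_mul, Polynomial.aeval_C, map_mul] at h1
      have e1 : conj (algebraMap ℝ ℂ a) = (a : ℂ) := by simp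
      rw [e1, mul_left_comm, Complex.im_ofReal_mul] at h1
      exact nonpos_of_mul_nonpos_right h1 ha
    have key := derivative_mul_le_mul_derivative (fun m _ => hy0 m) hdeg him
      (δ := c / 2) (by positivity) (by
        rw [d1]
        have := mul_le_mul_of_nonneg_left hΦ hF0.le
        linarith)
    have g0 : g.derivative.eval 0 =
        aeval w (MvPolynomial.pderiv i (MvPolynomial.pderiv j q)) := by
      rw [hg, derivative_line_single, eval_line_zero]
      congr 1
      exact pderiv_pderiv_comm j i q
    have gz : g.eval (c / 2) = aeval z (MvPolynomial.pderiv i q) := by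
      rw [hg, eval_line, hzw]
    rw [g0, gz] at key
    have key' : aeval w (MvPolynomial.pderiv i (MvPolynomial.pderiv j q)) * aeval z q ≤
        aeval z (MvPolynomial.pderiv i q) * aeval w (MvPolynomial.pderiv j q) := by
      rw [vz, v1]
      have := mul_le_mul_of_nonneg_left key ha.le
      linarith
    have hw1 := hq.pderiv_nonneg haw j le_rfl
    refine le_of_mul_le_mul_left ?_ hqz
    have := mul_le_mul_of_nonneg_left key' hc'
    have := mul_le_mul_of_nonneg_right hpi hw1
    linarith
  · have hn : (n : ℝ) ≤ e := by
      have h1 : (line q w (Pi.single j 1)).natDegree ≤ e :=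
        natDegree_le_of_iterate_derivative_eq_zero (by
          rw [iterate_derivative_line, he]; simp [line])
      rw [hl, Polynomial.natDegree_C_mul ha.ne', hF, natDegree_rootProd] at h1
      simpa using h1
    rw [v1, v2, d1, d2]
    set Φ := ∑ m, (y m)⁻¹ with hΦd
    set S := ∑ m, (y m)⁻¹ ^ 2 with hS
    have hS0 : 0 ≤ S := Finset.sum_nonneg fun m _ => sq_nonneg _
    have hΦ0 : 0 ≤ Φ := Finset.sum_nonneg fun m _ => (inv_pos.2 (hy0 m)).le
    have hnS : Φ ^ 2 ≤ e * S := by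
      have := sq_sum_le_card_mul_sum_sq (s := Finset.univ) (f := fun m => (y m)⁻¹)
      simp only [Finset.card_univ, Fintype.card_fin] at this
      exact this.trans (mul_le_mul_of_nonneg_right hn hS0)
    -- Cauchy–Schwarz with `y⁻¹ = x^(-1/2) · x^(1/2) y⁻¹`, where `x y⁻² = y⁻¹ + (c / 2) y⁻²`.
    have hCS : Φ ^ 2 ≤ (∑ m, (x m)⁻¹) * (Φ + c / 2 * S) := by
      have e1 : Φ + c / 2 * S = ∑ m, x m * (y m)⁻¹ ^ 2 := by
        rw [hΦd, hS, Finset.mul_sum, ← Finset.sum_add_distrib]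
        refine Finset.sum_congr rfl fun m _ => ?_
        have := (hy0 m).ne'
        have e2 : x m = y m + c / 2 := by simp [hy]
        rw [e2]
        field_simp
      rw [e1]
      refine Finset.sum_sq_le_sum_mul_sum_of_sq_le_mul _ (fun m _ => ?_) (fun m _ => ?_)
        fun m _ => ?_
      · have : 0 < x m := by linarith [hx m]
        positivity
      · have : 0 < x m := by linarith [hx m]
        positivity
      · have : 0 < x m := by linarith [hx m]
        exact le_of_eq (by field_simp)
    have h3 : c * Φ ^ 2 ≤ Φ + c / 2 * S := by
      have h4 : 0 ≤ Φ + c / 2 * S := by positivity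
      have := mul_le_mul_of_nonneg_left hCS hc.le
      have := mul_le_mul_of_nonneg_right hsum h4
      linarith
    -- For `e = 0` the factor `2e - 2` is negative, and the combination below is unavailable; there
    -- are then no roots at all.
    rcases Nat.eq_zero_or_pos e with rfl | hepos
    · have hS' : Φ = 0 := by
        have : Φ ^ 2 ≤ 0 := by simpa using hnS
        exact pow_eq_zero_iff (two_ne_zero) |>.1 (le_antisymm this (sq_nonneg _))
      have hn0 : n = 0 := by
        have : (n : ℝ) ≤ 0 := by simpa using hn
        exact_mod_cast le_antisymm this (Nat.cast_nonneg n)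
      subst hn0
      simp [hS, hΦd]
    have he1 : (1 : ℝ) ≤ e := by exact_mod_cast hepos
    -- Here `Φ² - S` is `f''/f`. The claim is `2e - 2` times `h3` plus `c` times `hnS`. It means
    -- that the barrier constant in direction `j` improves from `c` to `c (2e - 1) / (2e - 2)` after
    -- one derivative.
    have h5 : c * (2 * e - 1) * (Φ ^ 2 - S) ≤ (2 * e - 2) * Φ := by
      nlinarith [mul_le_mul_of_nonneg_left hnS hc.le,
        mul_le_mul_of_nonneg_left h3 (by linarith : (0 : ℝ) ≤ 2 * e - 2)]
    have := mul_le_mul_of_nonneg_left h5 (mul_pos ha hF0).le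
    linarith

end Barrier

end KadisonSinger


namespace KadisonSinger

open MvPolynomial

/-! ### Iterated derivatives -/

section Iterate

variable {σ R : Type*} [CommRing R]

/-- Fourth derivative in each of the variables of a list. -/
noncomputable def pderivFour : List σ → MvPolynomial σ R → MvPolynomial σ R
  | [], q => q
  | j :: l, q => pderivFour l ((pderiv j)^[4] q)

theorem pderivFour_zero (l : List σ) : pderivFour l (0 : MvPolynomial σ R) = 0 := by
  induction l with
  | nil => rfl
  | cons j l ih => rw [pderivFour, iterate_map_zero, ih]

theorem pderivFour_add (l : List σ) (p q : MvPolynomial σ R) :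
    pderivFour l (p + q) = pderivFour l p + pderivFour l q := by
  induction l generalizing p q with
  | nil => rfl
  | cons j l ih => rw [pderivFour, iterate_map_add, ih]; rfl

theorem pderivFour_sum (l : List σ) {κ : Type*} (s : Finset κ) (p : κ → MvPolynomial σ R) :
    pderivFour l (∑ c ∈ s, p c) = ∑ c ∈ s, pderivFour l (p c) := by
  classical
  induction s using Finset.induction_on with
  | empty => simp [pderivFour_zero]
  | insert c s hc ih => rw [Finset.sum_insert hc, Finset.sum_insert hc, pderivFour_add, ih]

theorem pderivFour_nsmul (l : List σ) (n : ℕ) (p : MvPolynomial σ R) :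
    pderivFour l (n • p) = n • pderivFour l p := by
  induction n with
  | zero => simp [pderivFour_zero]
  | succ n ih => rw [succ_nsmul, succ_nsmul, pderivFour_add, ih]

theorem pderiv_iterate_comm (i j : σ) (m n : ℕ) (q : MvPolynomial σ R) :
    (pderiv i)^[m] ((pderiv j)^[n] q) = (pderiv j)^[n] ((pderiv i)^[m] q) :=
  ((Function.Commute.iterate_left (f := pderiv (R := R) i) (g := pderiv (R := R) j)
    (fun q => pderiv_pderiv_comm i j q) m).iterate_right n) q

theorem pderiv_pderivFour (i : σ) (l : List σ) (q : MvPolynomial σ R) :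
    pderiv i (pderivFour l q) = pderivFour l (pderiv i q) := by
  induction l generalizing q with
  | nil => rfl
  | cons j l ih =>
    rw [pderivFour, pderivFour, ih]
    congr 1
    exact pderiv_iterate_comm i j 1 4 q

end Iterate

/-! ### The barrier argument for fourth derivatives. -/

section Barrier

variable {σ : Type*} [Fintype σ] [DecidableEq σ]

/-- Starting from degree at most 5 in `X j`, three improvements by 9/8, 7/6 and 5/4 turn `c` into
`9/8 c`, `21/16 c` and `105/64 c`. The four half-steps sum to `325/128 c`. Without the improvements
the shift would be only `2c`, too little for the final estimate. -/
theorem barrier_pderiv_four {q : MvPolynomial σ ℝ} (hq : Stable q) {z : σ → ℝ} (hz : Above q z)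
    {j : σ} (hj : (pderiv j)^[4] q ≠ 0) (hdeg : (pderiv j)^[6] q = 0) {c : ℝ} (hc : 0 < c)
    (hpot : c * aeval z (pderiv j q) ≤ aeval z q) :
    Stable ((pderiv j)^[4] q) ∧
    Above ((pderiv j)^[4] q) (z - Pi.single j (325 / 128 * c)) ∧
    ∀ (i : σ) (c' : ℝ), 0 ≤ c' → c' * aeval z (pderiv i q) ≤ aeval z q →
      c' * aeval (z - Pi.single j (325 / 128 * c)) (pderiv i ((pderiv j)^[4] q)) ≤
        aeval (z - Pi.single j (325 / 128 * c)) ((pderiv j)^[4] q) := by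
  simp only [Function.iterate_succ, Function.iterate_zero, Function.comp_apply, id] at hj hdeg ⊢
  have hj3 : pderiv j (pderiv j (pderiv j q)) ≠ 0 := fun h => hj (by rw [h, map_zero])
  have hj2 : pderiv j (pderiv j q) ≠ 0 := fun h => hj3 (by rw [h, map_zero])
  have hj1 : pderiv j q ≠ 0 := fun h => hj2 (by rw [h, map_zero])
  obtain ⟨s1, a1, p1, d1⟩ := barrier_step hq hz hj1 hc hpot
  have t1 := d1 5 (by simpa [Function.iterate_succ] using hdeg)
  obtain ⟨s2, a2, p2, d2⟩ := barrier_step s1 a1 hj2 (c := 9 / 8 * c) (by linarith)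
    (by push_cast at t1; linarith)
  have t2 := d2 4 (by simpa [Function.iterate_succ] using hdeg)
  obtain ⟨s3, a3, p3, d3⟩ := barrier_step s2 a2 hj3 (c := 21 / 16 * c) (by linarith)
    (by push_cast at t2; linarith)
  have t3 := d3 3 (by simpa [Function.iterate_succ] using hdeg)
  obtain ⟨s4, a4, p4, -⟩ := barrier_step s3 a3 hj (c := 105 / 64 * c) (by linarith)
    (by push_cast at t3; linarith)
  have e : z - Pi.single j (c / 2) - Pi.single j (9 / 8 * c / 2) - Pi.single j (21 / 16 * c / 2) -
      Pi.single j (105 / 64 * c / 2) = z - Pi.single j (325 / 128 * c) := by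
    simp only [sub_sub, ← Pi.single_add]
    congr 2
    ring
  rw [e] at a4 p4
  exact ⟨s4, a4, fun i c' hc' h => p4 i c' hc' (p3 i c' hc' (p2 i c' hc' (p1 i c' hc' h)))⟩

/-- Treating one variable does not spoil the barrier constants of the others, so the same `c` serves
for every entry of the list. -/
theorem barrier_pderivFour (l : List σ) {c : ℝ} (hc : 0 < c) {q : MvPolynomial σ ℝ}
    (hq : Stable q) {z : σ → ℝ} (hz : Above q z) (hl : pderivFour l q ≠ 0)
    (hdeg : ∀ j, (pderiv j)^[6] q = 0)
    (hpot : ∀ j, c * aeval z (pderiv j q) ≤ aeval z q) :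
    Above (pderivFour l q) (z - (l.map fun j => (Pi.single j (325 / 128 * c) : σ → ℝ)).sum) := by
  induction l generalizing q z with
  | nil => simpa [pderivFour] using hz
  | cons j l ih =>
    have hj : (pderiv j)^[4] q ≠ 0 := fun h => hl (by rw [pderivFour, h, pderivFour_zero])
    obtain ⟨h1, h2, h3⟩ := barrier_pderiv_four hq hz hj (hdeg j) hc (hpot j)
    have := ih h1 h2 hl (fun i => by rw [pderiv_iterate_comm, hdeg, iterate_map_zero])
      fun i => h3 i c hc.le (hpot i)
    rw [List.map_cons, List.sum_cons, ← sub_sub]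
    exact this

theorem stable_above_pderivFour {l : List σ} {q : MvPolynomial σ ℝ} (hq : Stable q) {z : σ → ℝ}
    (hz : Above q z) (hl : pderivFour l q ≠ 0) :
    Stable (pderivFour l q) ∧ Above (pderivFour l q) z := by
  have step : ∀ (n : ℕ) (j : σ) (q : MvPolynomial σ ℝ), Stable q → Above q z →
      (pderiv j)^[n] q ≠ 0 → Stable ((pderiv j)^[n] q) ∧ Above ((pderiv j)^[n] q) z := by
    intro n j
    induction n with
    | zero => exact fun q h1 h2 _ => ⟨h1, h2⟩
    | succ n ih =>
      intro q h1 h2 h3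
      rw [Function.iterate_succ_apply] at h3 ⊢
      have h0 : pderiv j q ≠ 0 := fun h => h3 (by rw [h, iterate_map_zero])
      exact ih _ (h1.pderiv h2 h0) (h2.pderiv h1 h0) h3
  induction l generalizing q with
  | nil => exact ⟨hq, hz⟩
  | cons j l ih =>
    have hj : (pderiv j)^[4] q ≠ 0 := fun h =>
      hl (by rw [pderivFour, h, pderivFour_zero])
    obtain ⟨h1, h2⟩ := step 4 j q hq hz hj
    exact ih h1 h2 hl

end Barrier

end KadisonSinger


namespace KadisonSinger

open MvPolynomial

/-! ### Choosing a colour for each variable -/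

section Leibniz

variable {σ : Type*} (j : σ)

/-- For factors affine in `X j`, four derivatives of a product of five leave exactly one factor
undifferentiated: this factor is the colour of `j`. -/
theorem pderiv_iterate_prod_five (f : Fin 5 → MvPolynomial σ ℝ)
    (hf : ∀ c, pderiv j (pderiv j (f c)) = 0) :
    (pderiv j)^[4] (∏ c, f c) =
      24 • ∑ c, ∏ c', (if c' = c then f c' else pderiv j (f c')) ∧
    (pderiv j)^[5] (∏ c, f c) = 120 • ∏ c, pderiv j (f c) ∧
    (pderiv j)^[6] (∏ c, f c) = 0 := by
  set a := f 0
  set b := f 1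
  set c := f 2
  set d := f 3
  set e := f 4
  set a' := pderiv j (f 0)
  set b' := pderiv j (f 1)
  set c' := pderiv j (f 2)
  set d' := pderiv j (f 3)
  set e' := pderiv j (f 4)
  have ha' : pderiv j a' = 0 := hf 0
  have hb' : pderiv j b' = 0 := hf 1
  have hc' : pderiv j c' = 0 := hf 2
  have hd' : pderiv j d' = 0 := hf 3
  have he' : pderiv j e' = 0 := hf 4
  have ha : pderiv j a = a' := rfl
  have hb : pderiv j b = b' := rfl
  have hc : pderiv j c = c' := rfl
  have hd : pderiv j d = d' := rfl
  have he : pderiv j e = e' := rfl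
  have e0 : ∏ c, f c = a * b * c * d * e := Fin.prod_univ_five f
  have k1 : pderiv j (a * b * c * d * e) = a' * b * c * d * e + a * b' * c * d * e +
      a * b * c' * d * e + a * b * c * d' * e + a * b * c * d * e' := by
    simp only [pderiv_mul, ha, hb, hc, hd, he]
    ring
  have k2 : pderiv j (a' * b * c * d * e + a * b' * c * d * e +
      a * b * c' * d * e + a * b * c * d' * e + a * b * c * d * e') =
      2 • (a' * b' * c * d * e + a' * b * c' * d * e + a' * b * c * d' * e + a' * b * c * d * e' +
        a * b' * c' * d * e + a * b' * c * d' * e + a * b' * c * d * e' + a * b * c' * d' * e +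
        a * b * c' * d * e' + a * b * c * d' * e') := by
    simp only [map_add, pderiv_mul, ha, hb, hc, hd, he, ha', hb', hc', hd', he']
    ring
  have k3 : pderiv j (2 • (a' * b' * c * d * e + a' * b * c' * d * e + a' * b * c * d' * e +
        a' * b * c * d * e' +
        a * b' * c' * d * e + a * b' * c * d' * e + a * b' * c * d * e' + a * b * c' * d' * e +
        a * b * c' * d * e' + a * b * c * d' * e')) =
      6 • (a * b * c' * d' * e' + a * b' * c * d' * e' + a * b' * c' * d * e' +
        a * b' * c' * d' * e + a' * b * c * d' * e' + a' * b * c' * d * e' + a' * b * c' * d' * e +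
        a' * b' * c * d * e' + a' * b' * c * d' * e + a' * b' * c' * d * e) := by
    simp only [map_nsmul, map_add, pderiv_mul, ha, hb, hc, hd, he, ha', hb', hc', hd', he']
    ring
  have k4 : pderiv j (6 • (a * b * c' * d' * e' + a * b' * c * d' * e' + a * b' * c' * d * e' +
        a * b' * c' * d' * e + a' * b * c * d' * e' + a' * b * c' * d * e' + a' * b * c' * d' * e +
        a' * b' * c * d * e' + a' * b' * c * d' * e + a' * b' * c' * d * e)) =
      24 • (a * b' * c' * d' * e' + a' * b * c' * d' * e' + a' * b' * c * d' * e' +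
        a' * b' * c' * d * e' + a' * b' * c' * d' * e) := by
    simp only [map_nsmul, map_add, pderiv_mul, ha, hb, hc, hd, he, ha', hb', hc', hd', he']
    ring
  have k5 : pderiv j (24 • (a * b' * c' * d' * e' + a' * b * c' * d' * e' +
        a' * b' * c * d' * e' + a' * b' * c' * d * e' + a' * b' * c' * d' * e)) =
      120 • (a' * b' * c' * d' * e') := by
    simp only [map_nsmul, map_add, pderiv_mul, ha, hb, hc, hd, he, ha', hb', hc', hd', he']
    ring
  have k6 : pderiv j (120 • (a' * b' * c' * d' * e')) = 0 := by
    simp only [map_nsmul, pderiv_mul, ha', hb', hc', hd', he']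
    ring
  have r4 : (pderiv j)^[4] (∏ c, f c) = 24 • (a * b' * c' * d' * e' + a' * b * c' * d' * e' +
        a' * b' * c * d' * e' + a' * b' * c' * d * e' + a' * b' * c' * d' * e) := by
    simp only [Function.iterate_succ, Function.iterate_zero, Function.comp_apply, id, e0, k1, k2,
      k3, k4]
  have r5 : (pderiv j)^[5] (∏ c, f c) = 120 • (a' * b' * c' * d' * e') := by
    rw [Function.iterate_succ_apply', r4, k5]
  refine ⟨?_, ?_, ?_⟩
  · rw [r4]
    simp [Fin.prod_univ_five, Fin.sum_univ_five]
    rfl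
  · rw [r5, Fin.prod_univ_five]
  · rw [Function.iterate_succ_apply', r5, k6]

theorem pderiv_prod_eq_zero {R κ : Type*} [CommRing R] (s : Finset κ) (f : κ → MvPolynomial σ R)
    (hf : ∀ c ∈ s, pderiv j (f c) = 0) : pderiv j (∏ c ∈ s, f c) = 0 := by
  classical
  induction s using Finset.induction_on with
  | empty => simp
  | insert c s hc ih =>
    rw [Finset.prod_insert hc, pderiv_mul, hf c (Finset.mem_insert_self c s),
      ih fun c' hc' => hf c' (Finset.mem_insert_of_mem hc'), zero_mul, mul_zero, add_zero]

end Leibniz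

/-! ### Families closed under erasing rows, and the selection of a colouring. -/

section Family

theorem stable_above_prod {σ κ : Type*} (s : Finset κ) (f : κ → MvPolynomial σ ℝ) {w : σ → ℝ}
    (h : ∀ c, Stable (f c) ∧ Above (f c) w) :
    Stable (∏ c ∈ s, f c) ∧ Above (∏ c ∈ s, f c) w := by
  classical
  induction s using Finset.induction_on with
  | empty => exact ⟨fun z _ => by simp, fun x _ => by simp⟩
  | insert c s hc ih =>
    rw [Finset.prod_insert hc]
    exact ⟨(h c).1.mul ih.1, (h c).2.mul ih.2⟩

variable {σ : Type*} [Fintype σ] [DecidableEq σ] {P : Finset σ → MvPolynomial σ ℝ}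

theorem family_ne_zero (hP : ∀ T, ∀ j ∉ T, pderiv j (P T) = P (insert j T))
    (hu : P Finset.univ = 1) (T : Finset σ) : P T ≠ 0 := by
  induction h : Tᶜ.card generalizing T with
  | zero =>
    rw [Finset.card_eq_zero, Finset.compl_eq_empty_iff] at h
    rw [h, hu]
    exact one_ne_zero
  | succ n ih =>
    obtain ⟨j, hj⟩ : Tᶜ.Nonempty := Finset.card_pos.1 (by omega)
    have hj' : j ∉ T := Finset.mem_compl.1 hj
    intro h0
    refine ih (insert j T) ?_ ?_
    · rw [Finset.compl_insert, Finset.card_erase_of_mem hj, h]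
      rfl
    · rw [← hP T j hj', h0, map_zero]

theorem family_stable (hP : ∀ T, ∀ j ∉ T, pderiv j (P T) = P (insert j T))
    (hu : P Finset.univ = 1) {w : σ → ℝ} (hs : Stable (P ∅)) (ha : Above (P ∅) w)
    (T : Finset σ) : Stable (P T) ∧ Above (P T) w := by
  induction T using Finset.induction_on with
  | empty => exact ⟨hs, ha⟩
  | insert j T hj ih =>
    have h0 := family_ne_zero hP hu (insert j T)
    rw [← hP T j hj] at h0 ⊢
    exact ⟨ih.1.pderiv ih.2 h0, ih.2.pderiv ih.1 h0⟩

/-- One more derivative in `j` differentiates all five factors once and gives a nonzero multiple of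
a product of the same kind, which induction handles. -/
theorem pderivFour_prod_ne_zero (hP : ∀ T, ∀ j ∉ T, pderiv j (P T) = P (insert j T))
    (hP' : ∀ T, ∀ j ∈ T, pderiv j (P T) = 0) (hu : P Finset.univ = 1)
    (l : List σ) (hl : l.Nodup) (T : Fin 5 → Finset σ) (hT : ∀ j ∈ l, ∀ c, j ∉ T c) :
    pderivFour l (∏ c, P (T c)) ≠ 0 := by
  induction l generalizing T with
  | nil => exact Finset.prod_ne_zero_iff.2 fun c _ => family_ne_zero hP hu _
  | cons j l ih =>
    have hj : ∀ c, pderiv j (P (T c)) = P (insert j (T c)) := fun c =>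
      hP _ j (hT j List.mem_cons_self c)
    have h5 := (pderiv_iterate_prod_five j (fun c => P (T c)) fun c => by
      rw [hj, hP' _ j (Finset.mem_insert_self _ _)]).2.1
    intro h0
    have h1 := congrArg (pderiv j) h0
    rw [map_zero, pderiv_pderivFour, pderivFour, ← Function.iterate_succ_apply,
      h5, pderivFour_nsmul] at h1
    simp only [hj] at h1
    rw [List.nodup_cons] at hl
    refine ih hl.2 (fun c => insert j (T c)) (fun i hi c => ?_) ?_
    · rw [Finset.mem_insert, not_or]
      exact ⟨fun h => hl.1 (h ▸ hi), hT i (List.mem_cons_of_mem _ hi) c⟩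
    · exact (smul_eq_zero.1 h1).resolve_left (by norm_num)

/-- The colour of `j` is chosen by a substitute for common interlacing: the five candidates `G c`
have the same derivative `G₀` in `X j`, and the strong Rayleigh inequality makes each `G c / G₀`
increasing on the orthant. So positivity of one candidate at `x₀` spreads to everything above `x₀`.
The set `T' c` collects rows erased from the `c`-th factor; `j ∉ T' c` means that `j` may receive
colour `c`. -/
theorem exists_colouring (hP : ∀ T, ∀ j ∉ T, pderiv j (P T) = P (insert j T))
    (hP' : ∀ T, ∀ j ∈ T, pderiv j (P T) = 0) (hu : P Finset.univ = 1) {w : σ → ℝ}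
    (hs : Stable (P ∅)) (ha : Above (P ∅) w) {x₀ : σ → ℝ}
    (l : List σ) (hl : l.Nodup) (T : Fin 5 → Finset σ) (hT : ∀ j ∈ l, ∀ c, j ∉ T c)
    (hx : Above (pderivFour l (∏ c, P (T c))) x₀) :
    ∃ T' : Fin 5 → Finset σ, (∀ j ∉ l, ∀ c, j ∈ T' c ↔ j ∈ T c) ∧
      (∀ j ∈ l, ∃ c, j ∉ T' c) ∧ Above (∏ c, P (T' c)) x₀ := by
  induction l generalizing T with
  | nil => exact ⟨T, by simp, by simp, hx⟩
  | cons j l ih =>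
    have hj : ∀ c, pderiv j (P (T c)) = P (insert j (T c)) := fun c =>
      hP _ j (hT j List.mem_cons_self c)
    have hl' := List.nodup_cons.1 hl
    obtain ⟨h4, h5, -⟩ := pderiv_iterate_prod_five j (fun c => P (T c)) fun c => by
      rw [hj, hP' _ j (Finset.mem_insert_self _ _)]
    simp only [hj] at h4 h5
    have hins : ∀ i ∈ l, ∀ c, i ∉ insert j (T c) := fun i hi c => by
      rw [Finset.mem_insert, not_or]
      exact ⟨fun h => hl'.1 (h ▸ hi), hT i (List.mem_cons_of_mem _ hi) c⟩
    set U : Fin 5 → Fin 5 → Finset σ := fun c c' => if c' = c then T c' else insert j (T c')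
      with hU
    have hUT : ∀ i ∈ l, ∀ c c', i ∉ U c c' := fun i hi c c' => by
      simp only [hU]
      split_ifs
      · exact hT i (List.mem_cons_of_mem _ hi) c'
      · exact hins i hi c'
    set G : Fin 5 → MvPolynomial σ ℝ := fun c => pderivFour l (∏ c', P (U c c')) with hG
    set G₀ := pderivFour l (∏ c, P (insert j (T c))) with hG₀
    have hsum : pderivFour (j :: l) (∏ c, P (T c)) = 24 • ∑ c, G c := by
      rw [pderivFour, h4, pderivFour_nsmul, pderivFour_sum]
      simp only [hG, hU, apply_ite P]
    have hfam := family_stable hP hu hs ha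
    have hprod : ∀ V : Fin 5 → Finset σ, Stable (∏ c, P (V c)) ∧ Above (∏ c, P (V c)) w :=
      fun V => stable_above_prod _ _ fun c => hfam (V c)
    have hGst : ∀ c, Stable (G c) := fun c =>
      (stable_above_pderivFour (hprod _).1 (hprod _).2
        (pderivFour_prod_ne_zero hP hP' hu l hl'.2 _ fun i hi c' => hUT i hi c c')).1
    have hst : Stable (pderivFour (j :: l) (∏ c, P (T c))) :=
      (stable_above_pderivFour (hprod _).1 (hprod _).2
        (pderivFour_prod_ne_zero hP hP' hu (j :: l) hl _ hT)).1
    have hdG : pderiv j (pderivFour (j :: l) (∏ c, P (T c))) = 120 • G₀ := by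
      rw [pderiv_pderivFour, pderivFour, ← Function.iterate_succ_apply, h5, pderivFour_nsmul]
    have hG₀0 : G₀ ≠ 0 := pderivFour_prod_ne_zero hP hP' hu l hl'.2 _ hins
    -- `120 G₀` is the derivative in `X j` of the whole sum, so it inherits positivity from the sum.
    have hG₀pos : Above G₀ x₀ := by
      have h1 := hx.pderiv hst (j := j) (by
        rw [hdG]
        exact fun h => hG₀0 ((smul_eq_zero.1 h).resolve_left (by norm_num)))
      intro x hx'
      have := h1 x hx'
      rw [hdG, map_nsmul, nsmul_eq_mul] at this
      push_cast at this
      linarith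
    have hdGc : ∀ c, pderiv j (G c) = G₀ := by
      intro c
      simp only [hG, hG₀]
      rw [pderiv_pderivFour]
      congr 1
      have e1 : ∀ c', c' ≠ c → pderiv j (P (U c c')) = 0 := fun c' hc' => by
        simp only [hU, if_neg hc']
        exact hP' _ j (Finset.mem_insert_self _ _)
      have e2 : pderiv j (∏ c' ∈ Finset.univ.erase c, P (U c c')) = 0 := by
        exact pderiv_prod_eq_zero j _ _ fun c' hc' => e1 c' (Finset.mem_erase.1 hc').1
      rw [← Finset.mul_prod_erase _ _ (Finset.mem_univ c), pderiv_mul, e2, mul_zero, add_zero,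
        ← Finset.mul_prod_erase _ _ (Finset.mem_univ c)]
      congr 1
      · simp [hU, hj]
      · refine Finset.prod_congr rfl fun c' hc' => ?_
        simp [hU, (Finset.mem_erase.1 hc').1]
    -- The candidates have positive sum at `x₀`.
    obtain ⟨c, hc⟩ : ∃ c, 0 < aeval x₀ (G c) := by
      by_contra! h
      have h1 := hx x₀ le_rfl
      rw [hsum, map_nsmul, map_sum, nsmul_eq_mul] at h1
      push_cast at h1
      have h2 := Finset.sum_nonpos fun c (_ : c ∈ Finset.univ) => h c
      linarith
    have hGc : Above (G c) x₀ := by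
      intro x hx'
      have h1 := div_le_div_of_pderiv_mul_le (N := -G c) hG₀pos (fun x _ i => by
        have := (hGst c).mul_pderiv_pderiv_le j i x
        rw [hdGc] at this
        simp only [map_neg]
        linarith) le_rfl hx'
      simp only [map_neg, neg_div, neg_le_neg_iff] at h1
      have h2 := div_pos hc (hG₀pos x₀ le_rfl)
      exact (div_pos_iff_of_pos_right (hG₀pos x hx')).1 (h2.trans_le h1)
    obtain ⟨T', t1, t2, t3⟩ := ih hl'.2 (U c) (fun i hi c' => hUT i hi c c') hGc
    refine ⟨T', fun i hi c' => ?_, fun i hi => ?_, t3⟩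
    · rw [List.mem_cons, not_or] at hi
      rw [t1 i hi.2 c']
      simp only [hU]
      split_ifs
      · rfl
      · rw [Finset.mem_insert]
        exact ⟨fun h => h.resolve_left hi.1, Or.inr⟩
    · rcases List.mem_cons.1 hi with rfl | hi
      · refine ⟨c, fun h => ?_⟩
        rw [t1 _ hl'.1] at h
        simp only [hU, if_true] at h
        exact hT _ List.mem_cons_self c h
      · exact t2 i hi

end Family

end KadisonSinger


namespace KadisonSinger

open MvPolynomial Matrix
open scoped ComplexOrder

/-! ### Determinants -/

section Det

variable {σ : Type*} [DecidableEq σ]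

/-- The matrix `diagonal d - B` with the rows in `T` replaced by those of the identity matrix. -/
def eraseRows {R : Type*} [CommRing R] (T : Finset σ) (d : σ → R) (B : Matrix σ σ R) :
    Matrix σ σ R :=
  of fun i l => if i ∈ T then (1 : Matrix σ σ R) i l else diagonal d i l - B i l

theorem map_eraseRows [Fintype σ] {R S : Type*} [CommRing R] [CommRing S] (f : R →+* S) (T : Finset σ)
    (d : σ → R) (B : Matrix σ σ R) :
    f.mapMatrix (eraseRows T d B) = eraseRows T (fun i => f (d i)) (B.map f) := by
  ext i l
  by_cases hil : i = l
  · subst hil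
    by_cases h : i ∈ T <;> simp [eraseRows, h]
  · by_cases h : i ∈ T <;> simp [eraseRows, h, hil]

theorem eraseRows_empty (z : σ → ℂ) (A : Matrix σ σ ℂ) :
    eraseRows ∅ z A = diagonal z - A := by
  ext1 i l; simp [eraseRows]

theorem posDef_diagonal_sub {A : Matrix σ σ ℂ} (h1 : (1 - A).PosSemidef) {x : σ → ℝ}
    (hx : ∀ i, 1 < x i) : (diagonal (fun i => (x i : ℂ)) - A).PosDef := by
  have h2 : (diagonal fun i => ((x i - 1 : ℝ) : ℂ)).PosDef := by
    refine PosDef.diagonal fun i => ?_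
    have := sub_pos.2 (hx i)
    exact_mod_cast this
  have h3 : diagonal (fun i => (x i : ℂ)) - A =
      (diagonal fun i => ((x i - 1 : ℝ) : ℂ)) + (1 - A) := by
    ext1 i l
    by_cases hil : i = l
    · subst hil; simp
    · simp [hil]
  rw [h3]
  exact h2.add_posSemidef h1

theorem pderiv_eraseRows (j : σ) (A : Matrix σ σ ℂ) (T : Finset σ) {i : σ} (l : σ)
    (h : i ∈ T ∨ i ≠ j) : pderiv j (eraseRows T X (A.map C) i l) = 0 := by
  by_cases hi : i ∈ T
  · by_cases hil : i = l
    · subst hil; simp [eraseRows, hi]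
    · simp [eraseRows, hi, hil]
  · have hij := h.resolve_left hi
    by_cases hil : i = l
    · subst hil
      simp [eraseRows, hi, pderiv_X_of_ne hij]
    · simp [eraseRows, hi, hil]

variable [Fintype σ]

/-- The polynomial `det (diagonal X - A)` with the rows in `T` erased. -/
noncomputable def detPoly (A : Matrix σ σ ℂ) (T : Finset σ) : MvPolynomial σ ℂ :=
  (eraseRows T X (A.map C)).det

theorem eval_detPoly (A : Matrix σ σ ℂ) (T : Finset σ) (z : σ → ℂ) :
    eval z (detPoly A T) = (eraseRows T z A).det := by
  rw [detPoly, RingHom.map_det, map_eraseRows]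
  congr 2
  · simp
  · ext i l; simp

theorem pderiv_det_eq_zero (j : σ) (M : Matrix σ σ (MvPolynomial σ ℂ))
    (h : ∀ i l, pderiv j (M i l) = 0) : pderiv j M.det = 0 := by
  rw [det_apply, map_sum]
  refine Finset.sum_eq_zero fun π _ => ?_
  rw [Units.smul_def, map_zsmul, pderiv_prod_eq_zero j _ _ fun i _ => h _ _, smul_zero]

theorem pderiv_detPoly_of_mem (A : Matrix σ σ ℂ) {T : Finset σ} {j : σ} (hj : j ∈ T) :
    pderiv j (detPoly A T) = 0 :=
  pderiv_det_eq_zero j _ fun i l => pderiv_eraseRows j A T l (by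
    by_cases h : i = j
    · exact Or.inl (h ▸ hj)
    · exact Or.inr h)

/-- Only row `j` contains `X j`, so the determinant is affine in it, and the coefficient is the
determinant with that row replaced by the unit vector. -/
theorem pderiv_detPoly_of_notMem (A : Matrix σ σ ℂ) {T : Finset σ} {j : σ} (hj : j ∉ T) :
    pderiv j (detPoly A T) = detPoly A (insert j T) := by
  set M := eraseRows T X (A.map C) with hM
  have h1 : M.updateRow j (Pi.single j 1) = eraseRows (insert j T) X (A.map C) := by
    ext1 i l
    by_cases hi : i = j
    · subst hi
      by_cases hil : i = l
      · subst hil; simp [eraseRows]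
      · simp [eraseRows, hil, Ne.symm hil]
    · simp [hi, eraseRows, hM]
  have h2 : M = M.updateRow j ((X j : MvPolynomial σ ℂ) • Pi.single j 1 +
      fun l => -C (A j l)) := by
    ext1 i l
    by_cases hi : i = j
    · subst hi
      by_cases hil : i = l
      · subst hil; simp [hM, eraseRows, hj, sub_eq_add_neg]
      · simp [hM, eraseRows, hj, hil, Ne.symm hil]
    · simp [hi]
  have h3 : pderiv j (M.updateRow j (Pi.single j 1)).det = 0 := by
    rw [h1]; exact pderiv_detPoly_of_mem A (Finset.mem_insert_self j T)
  have h4 : pderiv j (M.updateRow j fun l => -C (A j l)).det = 0 := by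
    refine pderiv_det_eq_zero j _ fun i l => ?_
    by_cases hi : i = j
    · subst hi; simp
    · rw [updateRow_ne hi]
      exact pderiv_eraseRows j A T l (Or.inr hi)
  have h5 : detPoly A T = X j * (M.updateRow j (Pi.single j 1)).det +
      (M.updateRow j fun l => -C (A j l)).det := by
    rw [detPoly, ← hM]
    conv_lhs => rw [h2]
    rw [det_updateRow_add, det_updateRow_smul]
  rw [h5, map_add, pderiv_mul, h3, h4, pderiv_X_self, mul_zero, add_zero, add_zero, one_mul, h1]
  rfl

theorem detPoly_univ (A : Matrix σ σ ℂ) : detPoly A Finset.univ = 1 := by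
  have : eraseRows Finset.univ X (A.map C) = (1 : Matrix σ σ (MvPolynomial σ ℂ)) := by
    ext1 i l; simp [eraseRows]
  rw [detPoly, this, det_one]

theorem exists_map_eq_detPoly {A : Matrix σ σ ℂ} (hA : A.IsHermitian) (T : Finset σ) :
    ∃ p : MvPolynomial σ ℝ, map (algebraMap ℝ ℂ) p = detPoly A T := by
  induction T using Finset.induction_on with
  | empty =>
    -- Conjugating the coefficients transposes the Hermitian pencil, which leaves the determinant
    -- unchanged. For nonempty `T` realness is inherited through derivatives.
    have hconj : map (starRingEnd ℂ) (detPoly A ∅) = detPoly A ∅ := by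
      rw [detPoly, RingHom.map_det, map_eraseRows, ← det_transpose]
      congr 1
      ext1 i l
      by_cases hil : i = l
      · subst hil
        have := hA.apply i i
        simp only [eraseRows, transpose_apply, of_apply, Finset.notMem_empty, if_false, map_X,
          Matrix.map_apply, map_C]
        rw [starRingEnd_apply, this]
      · have := hA.apply i l
        simp only [eraseRows, transpose_apply, of_apply, Finset.notMem_empty, if_false, map_X,
          Matrix.map_apply, map_C, diagonal_apply_ne _ hil, diagonal_apply_ne _ (Ne.symm hil)]
        rw [starRingEnd_apply, this]
    change detPoly A ∅ ∈ Set.range (map (algebraMap ℝ ℂ))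
    rw [mem_range_map_iff_coeffs_subset]
    intro a ha
    obtain ⟨m, -, rfl⟩ := mem_coeffs_iff.1 ha
    have h := congrArg (coeff m) hconj
    rw [coeff_map] at h
    exact ⟨_, Complex.conj_eq_iff_re.1 h⟩
  | insert j T hj ih =>
    obtain ⟨p, hp⟩ := ih
    exact ⟨pderiv j p, by rw [← pderiv_map, hp, pderiv_detPoly_of_notMem A hj]⟩

theorem aeval_eq_det {p : MvPolynomial σ ℝ} {A : Matrix σ σ ℂ} {T : Finset σ}
    (hp : map (algebraMap ℝ ℂ) p = detPoly A T) (z : σ → ℂ) :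
    aeval z p = (eraseRows T z A).det := by
  rw [← eval_detPoly, ← hp, eval_map]; rfl

/-- A kernel vector `v` of `diagonal z - A` gives `∑ zᵢ |vᵢ|² = ⟨v, A v⟩`, which is real; the
imaginary parts of the `zᵢ` are positive, so `v = 0`. -/
theorem stable_of_map_eq {p : MvPolynomial σ ℝ} {A : Matrix σ σ ℂ} (hA : A.IsHermitian)
    (hp : map (algebraMap ℝ ℂ) p = detPoly A ∅) : Stable p := by
  intro z hz h0
  rw [aeval_eq_det hp, eraseRows_empty, ← exists_mulVec_eq_zero_iff] at h0
  obtain ⟨v, hv, h⟩ := h0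
  have h1 : star v ⬝ᵥ (diagonal z *ᵥ v) = star v ⬝ᵥ (A *ᵥ v) := by
    rw [sub_mulVec, sub_eq_zero] at h
    rw [h]
  have h2 : (star v ⬝ᵥ (A *ᵥ v)).im = 0 := hA.im_star_dotProduct_mulVec_self v
  have h3 : (star v ⬝ᵥ (diagonal z *ᵥ v)).im = ∑ i, (z i).im * Complex.normSq (v i) := by
    rw [dotProduct, Complex.im_sum]
    refine Finset.sum_congr rfl fun i _ => ?_
    rw [mulVec_diagonal, Pi.star_apply, mul_left_comm, Complex.star_def,
      ← Complex.normSq_eq_conj_mul_self, Complex.im_mul_ofReal]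
  rw [h1, h2] at h3
  apply hv
  funext i
  have h4 := (Finset.sum_eq_zero_iff_of_nonneg fun i _ =>
    mul_nonneg (hz i).le (Complex.normSq_nonneg (v i))).1 h3.symm i (Finset.mem_univ i)
  exact Complex.normSq_eq_zero.1 ((mul_eq_zero.1 h4).resolve_left (hz i).ne')

theorem above_of_map_eq {p : MvPolynomial σ ℝ} {A : Matrix σ σ ℂ} (h1 : (1 - A).PosSemidef)
    (hp : map (algebraMap ℝ ℂ) p = detPoly A ∅) : Above p fun _ => 101 / 100 := by
  intro x hx
  have h2 := (posDef_diagonal_sub h1 (x := x) fun i => by linarith [hx i]).det_pos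
  rw [← eraseRows_empty, ← aeval_eq_det hp, ← ofReal_aeval] at h2
  exact_mod_cast h2

/-- The diagonal entries of the resolvent at `101 / 100` of a contraction with zero diagonal. -/
theorem adjugate_le {A : Matrix σ σ ℂ} (h1 : (1 - A).PosSemidef)
    (h2 : (1 + A).PosSemidef) {j : σ} (hj : A j j = 0) :
    201 * (adjugate (diagonal (fun _ => (101 / 100 : ℂ)) - A) j j).re ≤
      10100 * (diagonal (fun _ => (101 / 100 : ℂ)) - A).det.re := by
  set B := diagonal (fun _ => (101 / 100 : ℂ)) - A with hB
  have hB1 : 100 • B = 101 • 1 - 100 • A := by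
    have : (diagonal fun _ => (101 / 100 : ℂ)) = (101 / 100 : ℂ) • (1 : Matrix σ σ ℂ) := by
      rw [smul_one_eq_diagonal]
    have e : 100 • ((101 / 100 : ℂ) • (1 : Matrix σ σ ℂ)) = 101 • 1 := by
      rw [← Nat.cast_smul_eq_nsmul ℂ 100, ← Nat.cast_smul_eq_nsmul ℂ 101, smul_smul]
      congr 1
      norm_num
    rw [hB, this, smul_sub, e]
  have hpd : B.PosDef := by
    have := posDef_diagonal_sub h1 (x := fun _ => 101 / 100) fun _ => by norm_num
    simpa [hB] using this
  set d := B.det with hd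
  have hd0 : 0 < d := hpd.det_pos
  have hdre : (d.re : ℂ) = d := by
    have := (Complex.pos_iff.1 hd0).2
    exact Complex.ext rfl (by simpa using this)
  have hdpos : 0 < d.re := (Complex.pos_iff.1 hd0).1
  obtain ⟨v, hBv, hvj⟩ : ∃ v : σ → ℂ, B *ᵥ v = d • Pi.single j 1 ∧ v j = adjugate B j j :=
    ⟨adjugate B *ᵥ Pi.single j 1, by
      rw [mulVec_mulVec, mul_adjugate, smul_mulVec, one_mulVec], by simp⟩
  have hS : (1 - A)ᴴ = 1 - A := h1.1
  have hR : (1 + A)ᴴ = 1 + A := h2.1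
  have hBH : (100 • B)ᴴ = 100 • B := by
    rw [conjTranspose_nsmul, hpd.1.eq]
  have k1 : ((1 - A) * (1 + A) * (1 - A)).PosSemidef := by
    have := h2.conjTranspose_mul_mul_same (1 - A)
    rwa [hS] at this
  have k2 : ((1 + A) * (1 - A) * (1 + A)).PosSemidef := by
    have := h1.conjTranspose_mul_mul_same (1 + A)
    rwa [hR] at this
  -- This is the chord bound for the convex function `1/(101 - 100t)` on `[-1, 1]`, namely `1/(101 -
  -- 100t) ≤ (101 + 100t)/201`, with denominators cleared. The difference is `10000 (1 - t²)(101 -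
  -- 100t)`, written with visibly positive products. As `A j j = 0`, only the constant term of the
  -- chord survives in the diagonal entry.
  have hK : (100 • B) * (101 • 1 + 100 • A) * (100 • B) - 201 • (100 • B) =
      (5000 : ℝ) • ((1 - A) * (1 + A) * (1 - A) + (1 + A) * (1 - A) * (1 + A)) +
        (1000000 : ℝ) • ((1 - A) * (1 + A) * (1 - A)) := by
    rw [hB1]
    have e1 : ∀ M : Matrix σ σ ℂ, (5000 : ℝ) • M = 5000 • M := fun M => by
      rw [← Nat.cast_smul_eq_nsmul ℝ]; norm_num
    have e2 : ∀ M : Matrix σ σ ℂ, (1000000 : ℝ) • M = 1000000 • M := fun M => by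
      rw [← Nat.cast_smul_eq_nsmul ℝ]; norm_num
    rw [e1, e2]
    noncomm_ring
  have hpsd : ((100 • B) * (101 • 1 + 100 • A) * (100 • B) - 201 • (100 • B)).PosSemidef := by
    rw [hK]
    exact ((k1.add k2).smul (by norm_num)).add (k1.smul (by norm_num))
  have hv2 : (100 • B) *ᵥ v = (100 * d) • Pi.single j 1 := by
    rw [← Nat.cast_smul_eq_nsmul ℂ, smul_mulVec, hBv, smul_smul]
    norm_num
  have hnn := hpsd.dotProduct_mulVec_nonneg v
  have e1 : star v ⬝ᵥ (((100 • B) * (101 • 1 + 100 • A) * (100 • B)) *ᵥ v) =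
      star ((100 • B) *ᵥ v) ⬝ᵥ ((101 • 1 + 100 • A) *ᵥ ((100 • B) *ᵥ v)) := by
    rw [star_mulVec, hBH, ← dotProduct_mulVec, mulVec_mulVec, mulVec_mulVec, mul_assoc]
  have e2 : star v ⬝ᵥ ((201 • (100 • B)) *ᵥ v) = 201 * (100 * d) * star (v j) := by
    rw [← Nat.cast_smul_eq_nsmul ℂ 201, smul_mulVec, hv2]
    simp
    ring
  have e3 : ((101 • 1 + 100 • A : Matrix σ σ ℂ) *ᵥ Pi.single j 1) j = 101 := by
    rw [← Nat.cast_smul_eq_nsmul ℂ 101, ← Nat.cast_smul_eq_nsmul ℂ 100, mulVec_single_one]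
    simp [hj]
  rw [sub_mulVec, dotProduct_sub, e1, e2, hv2, mulVec_smul, star_smul, smul_dotProduct,
    dotProduct_smul] at hnn
  have e4 : star (Pi.single j (1 : ℂ) : σ → ℂ) ⬝ᵥ
      ((101 • 1 + 100 • A : Matrix σ σ ℂ) *ᵥ Pi.single j 1) = 101 := by
    have : star (Pi.single j (1 : ℂ) : σ → ℂ) = Pi.single j 1 := by
      rw [← Pi.single_star, star_one]
    rw [this, single_dotProduct, one_mul, e3]
  rw [e4, hvj, ← hdre] at hnn
  have hre := (Complex.nonneg_iff.1 hnn).1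
  simp at hre
  have : 100 * d.re * (201 * (adjugate B j j).re) ≤ 100 * d.re * (10100 * d.re) := by
    linarith
  exact le_of_mul_le_mul_left this (by linarith)

end Det

end KadisonSinger


namespace KadisonSinger

open MvPolynomial Matrix
open scoped ComplexOrder

/-! ### Paving of finite matrices -/

variable {σ : Type*} [DecidableEq σ] [Fintype σ]

theorem eraseRows_singleton (z : σ → ℂ) (A : Matrix σ σ ℂ) (j : σ) :
    (eraseRows {j} z A).det = adjugate (diagonal z - A) j j := by
  rw [adjugate_apply]
  congr 1
  ext1 i l
  by_cases hi : i = j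
  · subst hi
    by_cases hil : i = l
    · subst hil; simp [eraseRows]
    · simp [eraseRows, hil, Ne.symm hil]
  · simp [eraseRows, hi]

/-- If the polynomial with the rows in `T` erased has no large zeros, then the form of `A` is
bounded above on vectors supported outside `T`. -/
theorem re_dotProduct_le_of_det_ne_zero {A : Matrix σ σ ℂ} (hA : A.IsHermitian) (T : Finset σ)
    {x₀ : ℝ} (hx₀ : 0 ≤ x₀) (h : ∀ x : ℝ, x₀ ≤ x → (eraseRows T (fun _ => (x : ℂ)) A).det ≠ 0)
    {v : σ → ℂ} (hv : ∀ i ∈ T, v i = 0) :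
    (star v ⬝ᵥ A *ᵥ v).re ≤ x₀ * ∑ i, ‖v i‖ ^ 2 := by
  set B : Matrix σ σ ℂ := of fun i l => if i ∈ T ∨ l ∈ T then 0 else A i l with hB
  have hBA : ∀ u : σ → ℂ, (∀ i ∈ T, u i = 0) → ∀ i ∉ T, (B *ᵥ u) i = (A *ᵥ u) i := by
    intro u hu i hi
    simp only [mulVec, dotProduct]
    refine Finset.sum_congr rfl fun l _ => ?_
    by_cases hl : l ∈ T
    · simp [hu l hl]
    · simp [hB, hi, hl]
  have hBT : ∀ u : σ → ℂ, ∀ i ∈ T, (B *ᵥ u) i = 0 := by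
    intro u i hi
    simp only [mulVec, dotProduct]
    exact Finset.sum_eq_zero fun l _ => by simp [hB, hi]
  have hBH : B.IsHermitian := by
    ext1 i l
    simp only [conjTranspose_apply, hB, of_apply]
    by_cases hil : i ∈ T ∨ l ∈ T
    · rw [if_pos hil, if_pos hil.symm, star_zero]
    · rw [if_neg hil, if_neg (fun h => hil h.symm), hA.apply]
  have hH : ((x₀ : ℂ) • (1 : Matrix σ σ ℂ) - B).IsHermitian := by
    refine IsHermitian.sub ?_ hBH
    simp [IsHermitian, conjTranspose_smul]
  have hpsd : ((x₀ : ℂ) • (1 : Matrix σ σ ℂ) - B).PosSemidef := by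
    rw [hH.posSemidef_iff_eigenvalues_nonneg]
    intro k
    -- A negative eigenvalue of `x₀ - B` yields an eigenvector of the compression `B` with
    -- eigenvalue above `x₀ ≥ 0`. Being nonzero, this eigenvalue forces the vector to vanish on `T`,
    -- so the vector is in the kernel of the erased pencil.
    by_contra hneg
    simp only [Pi.zero_apply, not_le] at hneg
    set μ := hH.eigenvalues k
    set u : σ → ℂ := ⇑(hH.eigenvectorBasis k) with hu
    have hu0 : u ≠ 0 := fun h0 => by
      have := hH.eigenvectorBasis.orthonormal.ne_zero k
      exact this (by ext i; exact congrFun h0 i)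
    have hev := hH.mulVec_eigenvectorBasis k
    have hBu : B *ᵥ u = ((x₀ - μ : ℝ) : ℂ) • u := by
      rw [sub_mulVec, smul_mulVec, one_mulVec] at hev
      rw [← hu] at hev
      have : B *ᵥ u = (x₀ : ℂ) • u - μ • u := by rw [← hev]; simp
      rw [this]
      ext i
      simp
      ring
    have hpos : 0 < x₀ - μ := by linarith
    have huT : ∀ i ∈ T, u i = 0 := fun i hi => by
      have h1 := congrFun hBu i
      rw [hBT u i hi, Pi.smul_apply, smul_eq_mul] at h1
      refine (mul_eq_zero.1 h1.symm).resolve_left ?_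
      exact_mod_cast hpos.ne'
    refine h (x₀ - μ) (by linarith) (exists_mulVec_eq_zero_iff.1 ⟨u, hu0, ?_⟩)
    ext i
    by_cases hi : i ∈ T
    · have : (eraseRows T (fun _ => ((x₀ - μ : ℝ) : ℂ)) A *ᵥ u) i =
          ((1 : Matrix σ σ ℂ) *ᵥ u) i := by
        simp only [mulVec, dotProduct, eraseRows, of_apply, if_pos hi]
      rw [this, one_mulVec, huT i hi]
      rfl
    · have : (eraseRows T (fun _ => ((x₀ - μ : ℝ) : ℂ)) A *ᵥ u) i =
          ((diagonal (fun _ => ((x₀ - μ : ℝ) : ℂ)) - A) *ᵥ u) i := by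
        simp only [mulVec, dotProduct, eraseRows, of_apply, if_neg hi, Matrix.sub_apply]
      rw [this, sub_mulVec, Pi.sub_apply, ← hBA u huT i hi, hBu, mulVec_diagonal]
      simp
  have hnn := (Complex.nonneg_iff.1 (hpsd.dotProduct_mulVec_nonneg v)).1
  have h1 : star v ⬝ᵥ (B *ᵥ v) = star v ⬝ᵥ (A *ᵥ v) := by
    simp only [dotProduct]
    refine Finset.sum_congr rfl fun i _ => ?_
    by_cases hi : i ∈ T
    · simp [hv i hi]
    · rw [hBA v hv i hi]
  have h2 : star v ⬝ᵥ v = ((∑ i, ‖v i‖ ^ 2 : ℝ) : ℂ) := by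
    simp only [dotProduct]
    push_cast
    refine Finset.sum_congr rfl fun i _ => ?_
    rw [Pi.star_apply, Complex.star_def, Complex.conj_mul']
  rw [sub_mulVec, smul_mulVec, one_mulVec, dotProduct_sub, dotProduct_smul, h1, h2,
    smul_eq_mul, ← Complex.ofReal_mul, Complex.sub_re, Complex.ofReal_re] at hnn
  linarith

/-- A Hermitian contraction with zero diagonal can be paved with five colours so that each
diagonal block is bounded above by a constant smaller than `1`. -/
theorem exists_finite_paving {A : Matrix σ σ ℂ} (h1 : (1 - A).PosSemidef)
    (h2 : (1 + A).PosSemidef) (hdiag : ∀ j, A j j = 0) :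
    ∃ col : σ → Fin 5, ∀ (c : Fin 5) (v : σ → ℂ), (∀ i, col i ≠ c → v i = 0) →
      (star v ⬝ᵥ A *ᵥ v).re ≤ 9999 / 10000 * ∑ i, ‖v i‖ ^ 2 := by
  have hA : A.IsHermitian := by
    have := isHermitian_one.sub h1.1
    rwa [sub_sub_cancel] at this
  choose P hPA using exists_map_eq_detPoly hA
  have hinj := map_injective (σ := σ) (algebraMap ℝ ℂ) (algebraMap ℝ ℂ).injective
  have hP : ∀ T, ∀ j ∉ T, pderiv j (P T) = P (insert j T) := fun T j hj => hinj (by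
    rw [← pderiv_map, hPA, hPA, pderiv_detPoly_of_notMem A hj])
  have hP' : ∀ T, ∀ j ∈ T, pderiv j (P T) = 0 := fun T j hj => hinj (by
    rw [← pderiv_map, hPA, pderiv_detPoly_of_mem A hj, map_zero])
  have hu : P Finset.univ = 1 := hinj (by rw [hPA, detPoly_univ, map_one])
  have hs : Stable (P ∅) := stable_of_map_eq hA (hPA ∅)
  have ha : Above (P ∅) fun _ => 101 / 100 := above_of_map_eq h1 (hPA ∅)
  have hq := stable_above_prod Finset.univ (fun _ : Fin 5 => P ∅) fun _ => ⟨hs, ha⟩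
  have hdd : ∀ j, pderiv j (pderiv j (P ∅)) = 0 := fun j => by
    rw [hP ∅ j (Finset.notMem_empty j), hP' _ j (Finset.mem_insert_self _ _)]
  -- The logarithmic derivative of the fifth power is five times that of `P ∅`, which is at most
  -- `10100/201` by `adjugate_le`.
  have hpot : ∀ j, 201 / 50500 * aeval (fun _ => (101 / 100 : ℝ))
      (pderiv j (∏ _c : Fin 5, P ∅)) ≤ aeval (fun _ => (101 / 100 : ℝ)) (∏ _c : Fin 5, P ∅) := by
    intro j
    have e1 : ∏ _c : Fin 5, P ∅ = P ∅ ^ 5 := by simp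
    have hp0 := ha _ le_rfl
    have hval : ∀ T, aeval (fun _ => (101 / 100 : ℝ)) (P T) =
        (eraseRows T (fun _ => (101 / 100 : ℂ)) A).det.re := fun T => by
      rw [← aeval_eq_det (hPA T)]
      have := ofReal_aeval (P T) fun _ => (101 / 100 : ℝ)
      push_cast at this
      rw [← this, Complex.ofReal_re]
    have hadj := adjugate_le h1 h2 (hdiag j)
    rw [← eraseRows_singleton, ← eraseRows_empty, ← hval, ← hval] at hadj
    rw [e1, pderiv_pow, hP ∅ j (Finset.notMem_empty j), insert_empty_eq]
    simp only [map_mul, map_pow, map_natCast]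
    have h4 := pow_pos hp0 4
    push_cast
    nlinarith [mul_le_mul_of_nonneg_left hadj h4.le]
  have habove := barrier_pderivFour (Finset.univ : Finset σ).toList
    (c := 201 / 50500) (by norm_num) hq.1 hq.2
    (pderivFour_prod_ne_zero hP hP' hu _ (Finset.nodup_toList _) (fun _ => ∅) (by simp))
    (fun j => (pderiv_iterate_prod_five j (fun _ => P ∅) fun _ => hdd j).2.2) hpot
  -- Numerically `325/128 · 201/50500 ≈ 0.010106`, so the point drops from 1.01 to about 0.99989,
  -- below 0.9999.
  have hx₀ : ((fun _ => 101 / 100 : σ → ℝ) - ((Finset.univ : Finset σ).toList.map fun j =>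
      (Pi.single j (325 / 128 * (201 / 50500)) : σ → ℝ)).sum) ≤ fun _ => 9999 / 10000 := by
    intro i
    rw [Finset.sum_map_toList, Pi.sub_apply, Finset.sum_apply, Finset.sum_eq_single i]
    · rw [Pi.single_eq_same]; norm_num
    · intro j _ hj
      exact Pi.single_eq_of_ne hj.symm _
    · simp
  obtain ⟨T, -, hT, hab⟩ := exists_colouring hP hP' hu hs ha _ (Finset.nodup_toList _)
    (fun _ => ∅) (by simp) (habove.mono hx₀)
  choose col hcol using fun i => hT i (Finset.mem_toList.2 (Finset.mem_univ i))
  refine ⟨col, fun c v hv => ?_⟩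
  refine re_dotProduct_le_of_det_ne_zero hA (T c) (by norm_num) (fun x hx h0 => ?_)
    fun i hi => hv i fun h => hcol i (h ▸ hi)
  have hpos := hab (fun _ => x) fun _ => hx
  have hz : aeval (fun _ => x) (P (T c)) = 0 := by
    have h3 := ofReal_aeval (P (T c)) fun _ => x
    rw [aeval_eq_det (hPA (T c)), h0] at h3
    exact_mod_cast h3
  rw [map_prod, Finset.prod_eq_zero (Finset.mem_univ c) hz] at hpos
  exact lt_irrefl _ hpos

end KadisonSinger


namespace KadisonSinger

open Filter Topology Matrix
open scoped ComplexOrder ComplexConjugate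

/-! ### Paving of operators on `ℓ²` -/

theorem hasSum_single (x : Ell2) : HasSum (fun i => lp.single 2 i (x i)) x :=
  lp.hasSum_single (by simp) x

theorem tendsto_sum_single (x : Ell2) :
    Tendsto (fun N => ∑ i ∈ Finset.range N, lp.single (E := fun _ : ℕ => ℂ) 2 i (x i))
      atTop (𝓝 x) :=
  (hasSum_single x).tendsto_sum_nat

theorem norm_sq_sum_single (w : ℕ → ℂ) (N : ℕ) :
    ‖∑ i ∈ Finset.range N, lp.single (E := fun _ : ℕ => ℂ) 2 i (w i)‖ ^ 2 =
      ∑ i ∈ Finset.range N, ‖w i‖ ^ 2 := by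
  have h := lp.norm_sum_single (E := fun _ : ℕ => ℂ) (p := 2) (by simp) w (Finset.range N)
  simpa using h

theorem sum_single_apply (w : ℕ → ℂ) (N k : ℕ) :
    (∑ i ∈ Finset.range N, lp.single (E := fun _ : ℕ => ℂ) 2 i (w i) : Ell2) k =
      if k < N then w k else 0 := by
  rw [lp.coeFn_sum, Finset.sum_apply]
  simp only [lp.coeFn_single]
  by_cases hk : k < N
  · rw [Finset.sum_eq_single k]
    · simp [hk]
    · intro i _ hi
      simp [hi.symm]
    · intro h
      exact absurd (Finset.mem_range.2 hk) h
  · rw [if_neg hk]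
    refine Finset.sum_eq_zero fun i hi => ?_
    have : k ≠ i := fun h => hk (h ▸ Finset.mem_range.1 hi)
    simp [this]

/-- The `(i, l)` entry of the matrix of `A`. -/
noncomputable def entry (A : BEll2) (i l : ℕ) : ℂ := A (lp.single 2 l 1) i

theorem inner_sum_single (A : BEll2) (w : ℕ → ℂ) (N : ℕ) :
    inner ℂ (∑ i ∈ Finset.range N, lp.single (E := fun _ : ℕ => ℂ) 2 i (w i) : Ell2)
      (A (∑ i ∈ Finset.range N, lp.single 2 i (w i))) =
      ∑ i ∈ Finset.range N, ∑ l ∈ Finset.range N, conj (w i) * (entry A i l * w l) := by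
  rw [sum_inner]
  refine Finset.sum_congr rfl fun i _ => ?_
  rw [lp.inner_single_left, map_sum, lp.coeFn_sum, Finset.sum_apply, inner_sum]
  refine Finset.sum_congr rfl fun l _ => ?_
  have : (lp.single 2 l (w l) : Ell2) = w l • lp.single 2 l 1 := by
    rw [← lp.single_smul, smul_eq_mul, mul_one]
  rw [this, map_smul, lp.coeFn_smul, Pi.smul_apply, entry]
  simp
  ring

theorem conj_entry {A : BEll2} (hA : IsSelfAdjoint A) (i l : ℕ) :
    conj (entry A l i) = entry A i l := by
  have h := ContinuousLinearMap.adjoint_inner_left A (lp.single 2 i (1 : ℂ) : Ell2)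
    (lp.single 2 l (1 : ℂ))
  rw [← ContinuousLinearMap.star_eq_adjoint, hA.star_eq, lp.inner_single_left,
    lp.inner_single_right] at h
  simpa [entry] using (congrArg conj h).symm

/-- The quadratic form of `A` is bounded above by `M` on vectors supported on `S`. -/
def FormLE (A : BEll2) (S : Set ℕ) (M : ℝ) : Prop :=
  ∀ x : Ell2, (∀ n ∉ S, x n = 0) → (inner ℂ x (A x)).re ≤ M * ‖x‖ ^ 2

theorem FormLE.subset {A : BEll2} {S S' : Set ℕ} {M : ℝ} (h : FormLE A S M) (hS : S' ⊆ S) :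
    FormLE A S' M := fun x hx => h x fun n hn => hx n fun hn' => hn (hS hn')

theorem formLE_of_sum_single {A : BEll2} {S : Set ℕ} {M : ℝ}
    (h : ∀ (w : ℕ → ℂ) (N : ℕ), (∀ n ∉ S, w n = 0) →
      (inner ℂ (∑ i ∈ Finset.range N, lp.single (E := fun _ : ℕ => ℂ) 2 i (w i) : Ell2)
        (A (∑ i ∈ Finset.range N, lp.single 2 i (w i)))).re ≤
        M * ∑ i ∈ Finset.range N, ‖w i‖ ^ 2) : FormLE A S M := by
  intro x hx
  have ht := tendsto_sum_single x
  have c1 : Continuous fun y : Ell2 => (inner ℂ y (A y)).re :=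
    Complex.continuous_re.comp (continuous_id.inner A.continuous)
  have c2 : Continuous fun y : Ell2 => M * ‖y‖ ^ 2 := by fun_prop
  refine le_of_tendsto_of_tendsto ((c1.tendsto x).comp ht) ((c2.tendsto x).comp ht)
    (Eventually.of_forall fun N => ?_)
  simp only [Function.comp_apply]
  rw [norm_sq_sum_single]
  exact h (fun i => x i) N hx

open Classical in
/-- The compression of `A` to the coordinates in `S` smaller than `N`. -/
noncomputable def truncation (A : BEll2) (S : Set ℕ) (M : ℝ) (N : ℕ) :
    Matrix (Fin N) (Fin N) ℂ :=
  of fun i l => if (i : ℕ) ∈ S ∧ (l : ℕ) ∈ S then (M⁻¹ : ℂ) * entry A i l else 0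

theorem truncation_form (A : BEll2) (S : Set ℕ) (M : ℝ) (N : ℕ) {v : Fin N → ℂ} {w : ℕ → ℂ}
    (hw : ∀ i : Fin N, (i : ℕ) ∈ S → w i = v i) (hS : ∀ n ∉ S, w n = 0) :
    star v ⬝ᵥ (truncation A S M N *ᵥ v) = (M⁻¹ : ℂ) *
      inner ℂ (∑ i ∈ Finset.range N, lp.single (E := fun _ : ℕ => ℂ) 2 i (w i) : Ell2)
        (A (∑ i ∈ Finset.range N, lp.single 2 i (w i))) := by
  classical
  rw [inner_sum_single, ← Fin.sum_univ_eq_sum_range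
    (fun i => ∑ l ∈ Finset.range N, conj (w i) * (entry A i l * w l)), Finset.mul_sum, dotProduct]
  refine Finset.sum_congr rfl fun i _ => ?_
  rw [← Fin.sum_univ_eq_sum_range (fun l => conj (w i) * (entry A i l * w l)), Finset.mul_sum,
    mulVec, dotProduct, Finset.mul_sum]
  refine Finset.sum_congr rfl fun l _ => ?_
  by_cases hi : (i : ℕ) ∈ S
  · by_cases hl : (l : ℕ) ∈ S
    · rw [hw i hi, hw l hl]
      simp [truncation, hi, hl]
      ring
    · simp [truncation, hl, hS _ hl]
  · simp [truncation, hi, hS _ hi]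

/-- Finite truncations, rescaled by `M⁻¹` and set to zero outside `S`, are contractions with zero
diagonal. Their colourings are combined by compactness, taking limits along a nonprincipal
ultrafilter. -/
theorem exists_paving_upper {A : BEll2} (hA : IsSelfAdjoint A) (hdiag : ∀ n, entry A n n = 0)
    {S : Set ℕ} {M : ℝ} (hM : 0 < M) (h1 : FormLE A S M) (h2 : FormLE (-A) S M) :
    ∃ col : ℕ → Fin 5, ∀ c, FormLE A {n | n ∈ S ∧ col n = c} (9999 / 10000 * M) := by
  classical
  have hherm : ∀ N, (truncation A S M N).IsHermitian := by
    intro N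
    ext1 i l
    rw [conjTranspose_apply]
    simp only [truncation, of_apply]
    by_cases h : (i : ℕ) ∈ S ∧ (l : ℕ) ∈ S
    · rw [if_pos h, if_pos h.symm, star_mul', ← conj_entry hA]
      simp
    · rw [if_neg h, if_neg fun h' => h h'.symm, star_zero]
  have hbound : ∀ N, ∀ v : Fin N → ℂ,
      |(star v ⬝ᵥ (truncation A S M N *ᵥ v)).re| ≤ ∑ i, ‖v i‖ ^ 2 := by
    intro N v
    set w : ℕ → ℂ := fun n => if h : n < N ∧ n ∈ S then v ⟨n, h.1⟩ else 0 with hw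
    have hwS : ∀ n ∉ S, w n = 0 := fun n hn => by simp [hw, hn]
    have hwv : ∀ i : Fin N, (i : ℕ) ∈ S → w i = v i := fun i hi => by simp [hw, hi]
    rw [truncation_form A S M N hwv hwS]
    set V : Ell2 := ∑ i ∈ Finset.range N, lp.single 2 i (w i) with hV
    have hVS : ∀ n ∉ S, V n = 0 := fun n hn => by
      rw [hV, sum_single_apply, hwS n hn, ite_self]
    have hnorm : ‖V‖ ^ 2 ≤ ∑ i, ‖v i‖ ^ 2 := by
      rw [hV, norm_sq_sum_single, ← Fin.sum_univ_eq_sum_range (fun i => ‖w i‖ ^ 2)]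
      refine Finset.sum_le_sum fun i _ => ?_
      by_cases hi : (i : ℕ) ∈ S
      · rw [hwv i hi]
      · rw [hwS i hi]
        simp
    have a1 := h1 V hVS
    have a2 := h2 V hVS
    rw [_root_.neg_apply, inner_neg_right, Complex.neg_re] at a2
    have e : ((M⁻¹ : ℂ) * inner ℂ V (A V)).re = M⁻¹ * (inner ℂ V (A V)).re := by
      rw [← Complex.ofReal_inv, Complex.re_ofReal_mul]
    rw [e, abs_mul, abs_of_pos (inv_pos.2 hM)]
    calc M⁻¹ * |(inner ℂ V (A V)).re| ≤ M⁻¹ * (M * ‖V‖ ^ 2) := by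
          gcongr
          exact abs_le.2 ⟨by linarith, a1⟩
      _ = ‖V‖ ^ 2 := by field_simp
      _ ≤ _ := hnorm
  have hnsq : ∀ N, ∀ v : Fin N → ℂ, star v ⬝ᵥ v = ((∑ i, ‖v i‖ ^ 2 : ℝ) : ℂ) := by
    intro N v
    simp only [dotProduct]
    push_cast
    refine Finset.sum_congr rfl fun i _ => ?_
    rw [Pi.star_apply, Complex.star_def, Complex.conj_mul']
  have hfin : ∀ N, ∃ col : Fin N → Fin 5, ∀ (c : Fin 5) (v : Fin N → ℂ),
      (∀ i, col i ≠ c → v i = 0) →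
      (star v ⬝ᵥ truncation A S M N *ᵥ v).re ≤ 9999 / 10000 * ∑ i, ‖v i‖ ^ 2 := by
    intro N
    have him : ∀ v : Fin N → ℂ, (star v ⬝ᵥ truncation A S M N *ᵥ v).im = 0 := fun v =>
      (hherm N).im_star_dotProduct_mulVec_self v
    refine exists_finite_paving ?_ ?_ fun j => ?_
    · refine PosSemidef.of_dotProduct_mulVec_nonneg (isHermitian_one.sub (hherm N)) fun v => ?_
      rw [sub_mulVec, one_mulVec, dotProduct_sub, hnsq, Complex.nonneg_iff]
      have := (abs_le.1 (hbound N v)).2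
      constructor
      · rw [Complex.sub_re, Complex.ofReal_re]
        linarith
      · rw [Complex.sub_im, Complex.ofReal_im, him v, sub_zero]
    · refine PosSemidef.of_dotProduct_mulVec_nonneg (isHermitian_one.add (hherm N)) fun v => ?_
      rw [add_mulVec, one_mulVec, dotProduct_add, hnsq, Complex.nonneg_iff]
      have := (abs_le.1 (hbound N v)).1
      constructor
      · rw [Complex.add_re, Complex.ofReal_re]
        linarith
      · rw [Complex.add_im, Complex.ofReal_im, him v, add_zero]
    · simp [truncation, hdiag]
  choose colN hcolN using hfin
  set colE : ℕ → ℕ → Fin 5 := fun N i => if h : i < N then colN N ⟨i, h⟩ else 0 with hcolE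
  have hlim : ∀ i, ∃ c, ∀ᶠ N in (hyperfilter ℕ : Filter ℕ), colE N i = c := by
    intro i
    -- An ultrafilter on the finite set of colours is principal.
    obtain ⟨c, hc⟩ := ((hyperfilter ℕ).map fun N => colE N i).eq_pure_of_finite
    refine ⟨c, ?_⟩
    have : {c} ∈ (hyperfilter ℕ).map fun N => colE N i := by rw [hc]; exact mem_pure.2 rfl
    exact this
  choose col hcol using hlim
  refine ⟨col, fun c => formLE_of_sum_single fun w N hw => ?_⟩
  have hev : ∀ᶠ K in (hyperfilter ℕ : Filter ℕ), N ≤ K ∧ ∀ i ∈ Finset.range N, colE K i = col i :=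
    ((eventually_ge_atTop N).filter_mono Nat.hyperfilter_le_atTop).and
      ((Finset.eventually_all _).2 fun i _ => hcol i)
  -- A vector with finitely many nonzero coordinates sees only finitely many colours, so one
  -- truncation `K` agrees with the limit on all of them.
  obtain ⟨K, hNK, hK⟩ := hev.exists
  set w' : ℕ → ℂ := fun n => if n < N then w n else 0 with hw'
  have hsum : ∑ i ∈ Finset.range K, lp.single (E := fun _ : ℕ => ℂ) 2 i (w' i) =
      ∑ i ∈ Finset.range N, lp.single (E := fun _ : ℕ => ℂ) 2 i (w i) := by
    apply lp.ext
    funext k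
    rw [sum_single_apply, sum_single_apply]
    by_cases hk : k < N
    · simp [hw', hk, hk.trans_le hNK]
    · simp [hw', hk]
  have hnorm : ∑ i : Fin K, ‖w' i‖ ^ 2 = ∑ i ∈ Finset.range N, ‖w i‖ ^ 2 := by
    rw [Fin.sum_univ_eq_sum_range (fun i => ‖w' i‖ ^ 2), ← norm_sq_sum_single, hsum,
      norm_sq_sum_single]
  have hwS : ∀ n ∉ S, w' n = 0 := fun n hn => by
    simp only [hw']
    split_ifs
    · exact hw n fun h => hn h.1
    · rfl
  have key := hcolN K c (fun i => w' i) (fun i hi => by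
    simp only [hw']
    split_ifs with h
    · refine hw _ fun hmem => hi ?_
      have h3 := hK i (Finset.mem_range.2 h)
      rw [hmem.2] at h3
      simpa [hcolE] using h3
    · rfl)
  rw [truncation_form A S M K (w := w') (fun i _ => rfl) hwS, hsum, hnorm, ← Complex.ofReal_inv,
    Complex.re_ofReal_mul, inv_mul_le_iff₀ hM] at key
  linarith

end KadisonSinger


namespace KadisonSinger

open scoped ComplexOrder ComplexConjugate

/-! ### Diagonal operators and the conditional expectation -/

theorem norm_sq_eq_tsum (x : Ell2) : ‖x‖ ^ 2 = ∑' n, ‖x n‖ ^ 2 := by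
  have h := lp.norm_rpow_eq_tsum (p := 2) (by simp) x
  simpa using h

theorem summable_norm_sq (x : Ell2) : Summable fun n => ‖x n‖ ^ 2 := by
  have h := (lp.memℓp x).summable (by simp)
  simpa using h

theorem memℓp_mul {d : ℕ → ℂ} {C : ℝ} (hd : ∀ n, ‖d n‖ ≤ C) (x : Ell2) :
    Memℓp (fun n => d n * x n) 2 := by
  refine memℓp_gen (Summable.of_nonneg_of_le (fun n => by positivity) (fun n => ?_)
    ((summable_norm_sq x).mul_left (C ^ 2)))
  rw [ENNReal.toReal_ofNat, Real.rpow_ofNat, norm_mul, mul_pow]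
  gcongr
  exact hd n

/-- The diagonal operator with diagonal `d`. -/
noncomputable def mulOp (d : ℕ → ℂ) (C : ℝ) (hd : ∀ n, ‖d n‖ ≤ C) : BEll2 :=
  LinearMap.mkContinuous
    { toFun := fun x => (⟨fun n => d n * x n, memℓp_mul hd x⟩ : Ell2)
      map_add' := fun x y => by
        ext n
        exact mul_add _ _ _
      map_smul' := fun c x => by
        ext n
        exact mul_left_comm _ _ _ } C fun x => by
    have hC : 0 ≤ C := (norm_nonneg _).trans (hd 0)
    refine le_of_sq_le_sq ?_ (by positivity)
    rw [mul_pow, norm_sq_eq_tsum, norm_sq_eq_tsum, ← tsum_mul_left]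
    refine (summable_norm_sq _).tsum_le_tsum (fun n => ?_) ((summable_norm_sq x).mul_left _)
    change ‖d n * x n‖ ^ 2 ≤ _
    rw [norm_mul, mul_pow]
    gcongr
    exact hd n

theorem mulOp_apply {d : ℕ → ℂ} {C : ℝ} (hd : ∀ n, ‖d n‖ ≤ C) (x : Ell2) (n : ℕ) :
    mulOp d C hd x n = d n * x n := rfl

theorem norm_mulOp_le {d : ℕ → ℂ} {C : ℝ} (hd : ∀ n, ‖d n‖ ≤ C) : ‖mulOp d C hd‖ ≤ C :=
  LinearMap.mkContinuous_norm_le _ ((norm_nonneg _).trans (hd 0)) _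

theorem norm_entry_le (T : BEll2) (i l : ℕ) : ‖entry T i l‖ ≤ ‖T‖ := by
  refine (lp.norm_apply_le_norm (by simp) (T (lp.single 2 l 1)) i).trans ?_
  refine (T.le_opNorm _).trans ?_
  rw [lp.norm_single (by simp)]
  simp

/-- The conditional expectation onto the diagonal, as a map into the diagonal algebra. -/
noncomputable def diagPart : BEll2 →L[ℂ] diagonalAlgebra :=
  LinearMap.mkContinuous
    { toFun := fun T => ⟨mulOp (fun n => entry T n n) ‖T‖ fun n => norm_entry_le T n n,
        fun n => entry T n n, fun x n => mulOp_apply _ x n⟩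
      map_add' := fun S T => by
        ext x n
        exact add_mul _ _ _
      map_smul' := fun c T => by
        ext x n
        exact mul_assoc _ _ _ } 1 fun T => by
    rw [one_mul]
    exact norm_mulOp_le fun n => norm_entry_le T n n

theorem diagPart_apply (T : BEll2) (x : Ell2) (n : ℕ) :
    (diagPart T : BEll2) x n = entry T n n * x n := rfl

theorem apply_eq_entry_mul (a : diagonalAlgebra) (x : Ell2) (n : ℕ) :
    (a : BEll2) x n = entry (a : BEll2) n n * x n := by
  obtain ⟨d, hd⟩ := a.2
  have hd' : ∀ (x : Ell2) (n : ℕ), (a : BEll2) x n = d n * x n := hd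
  rw [entry, hd', hd']
  simp

theorem diagPart_coe (a : diagonalAlgebra) : diagPart (a : BEll2) = a := by
  ext x n
  rw [diagPart_apply, ← apply_eq_entry_mul]

theorem entry_sub (S T : BEll2) (i l : ℕ) : entry (S - T) i l = entry S i l - entry T i l := rfl

theorem entry_sub_diagPart (T : BEll2) (n : ℕ) : entry (T - (diagPart T : BEll2)) n n = 0 := by
  rw [entry_sub, entry, entry, diagPart_apply]
  simp [entry]

theorem nonneg_of_inner {T : BEll2} (h : ∀ x, 0 ≤ inner ℂ x (T x)) : 0 ≤ T := by
  rw [ContinuousLinearMap.nonneg_iff_isPositive, ContinuousLinearMap.isPositive_iff_complex]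
  intro x
  have hx := h x
  have h2 : inner ℂ (T x) x = inner ℂ x (T x) := by
    rw [← inner_conj_symm, Complex.conj_eq_iff_im]
    exact (Complex.nonneg_iff.1 hx).2.symm
  rw [h2]
  exact ⟨Complex.ext rfl (Complex.nonneg_iff.1 hx).2, (Complex.nonneg_iff.1 hx).1⟩

theorem inner_nonneg_of_nonneg {T : BEll2} (h : 0 ≤ T) (x : Ell2) : 0 ≤ inner ℂ x (T x) :=
  ((ContinuousLinearMap.nonneg_iff_isPositive T).1 h).inner_nonneg_right x

theorem entry_nonneg {T : BEll2} (h : 0 ≤ T) (n : ℕ) : 0 ≤ entry T n n := by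
  have := inner_nonneg_of_nonneg h (lp.single 2 n 1)
  rw [lp.inner_single_left] at this
  simpa [entry] using this

theorem nonneg_of_entry_nonneg {a : diagonalAlgebra} (h : ∀ n, 0 ≤ entry (a : BEll2) n n) :
    0 ≤ a := by
  change 0 ≤ (a : BEll2)
  refine nonneg_of_inner fun x => ?_
  rw [lp.inner_eq_tsum]
  refine tsum_nonneg fun n => ?_
  rw [apply_eq_entry_mul]
  have : inner ℂ (x n) (entry (a : BEll2) n n * x n) =
      entry (a : BEll2) n n * (conj (x n) * x n) := by
    simp
    ring
  rw [this]
  refine mul_nonneg (h n) ?_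
  exact star_mul_self_nonneg (x n)

theorem diagPart_nonneg {T : BEll2} (h : 0 ≤ T) : 0 ≤ diagPart T := by
  refine nonneg_of_entry_nonneg fun n => ?_
  rw [entry, diagPart_apply]
  simpa using entry_nonneg h n

theorem IsState.comp_diagPart {s : diagonalAlgebra →L[ℂ] ℂ} (hs : IsState s) :
    IsState (s.comp diagPart) := by
  refine ⟨fun T hT => hs.1 _ (diagPart_nonneg hT), ?_⟩
  have : diagPart 1 = 1 := diagPart_coe 1
  rw [ContinuousLinearMap.comp_apply, this]
  exact hs.2

/-- The coordinate projection onto the sequences supported on `S`. -/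
noncomputable def proj (S : Set ℕ) : diagonalAlgebra :=
  ⟨mulOp (S.indicator 1) 1 fun n => by
      by_cases h : n ∈ S <;> simp [h], S.indicator 1, fun x n => mulOp_apply _ x n⟩

theorem proj_apply (S : Set ℕ) (x : Ell2) (n : ℕ) :
    (proj S : BEll2) x n = S.indicator 1 n * x n := rfl

theorem diagonal_ext {a b : diagonalAlgebra}
    (h : ∀ n, entry (a : BEll2) n n = entry (b : BEll2) n n) : a = b := by
  ext x n
  rw [apply_eq_entry_mul, apply_eq_entry_mul, h]

theorem entry_mul (a b : diagonalAlgebra) (n : ℕ) :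
    entry ((a * b : diagonalAlgebra) : BEll2) n n =
      entry (a : BEll2) n n * entry (b : BEll2) n n := by
  have : entry ((a * b : diagonalAlgebra) : BEll2) n n =
    (a : BEll2) ((b : BEll2) (lp.single 2 n 1)) n := rfl
  rw [this, apply_eq_entry_mul]
  rfl

theorem entry_proj (S : Set ℕ) (n : ℕ) : entry (proj S : BEll2) n n = S.indicator 1 n := by
  rw [entry, proj_apply]
  simp

theorem entry_one (n : ℕ) : entry ((1 : diagonalAlgebra) : BEll2) n n = 1 := by
  have : entry ((1 : diagonalAlgebra) : BEll2) n n = (lp.single 2 n (1 : ℂ) : Ell2) n := rfl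
  rw [this]
  simp

theorem entry_add (a b : diagonalAlgebra) (n : ℕ) :
    entry ((a + b : diagonalAlgebra) : BEll2) n n =
      entry (a : BEll2) n n + entry (b : BEll2) n n := rfl

theorem proj_add_proj_compl (S : Set ℕ) : proj S + proj Sᶜ = 1 := by
  refine diagonal_ext fun n => ?_
  rw [entry_add, entry_proj, entry_proj, entry_one]
  by_cases h : n ∈ S <;> simp [h]

theorem proj_nonneg (S : Set ℕ) : 0 ≤ proj S := by
  refine nonneg_of_entry_nonneg fun n => ?_
  rw [entry_proj]
  by_cases h : n ∈ S <;> simp [h]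

theorem proj_mul_nonneg (S : Set ℕ) {a : diagonalAlgebra} (ha : 0 ≤ a) : 0 ≤ proj S * a := by
  refine nonneg_of_entry_nonneg fun n => ?_
  rw [entry_mul, entry_proj]
  refine mul_nonneg ?_ (entry_nonneg ha n)
  by_cases h : n ∈ S <;> simp [h]

theorem proj_mul_self (S : Set ℕ) : proj S * proj S = proj S := by
  refine diagonal_ext fun n => ?_
  rw [entry_mul, entry_proj]
  by_cases h : n ∈ S <;> simp [h]

/-! ### Pure states of the diagonal algebra -/

/-- This is `s` conditioned on `S`. The conditionings on `S` and on its complement exhibit `s` as a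
convex combination. -/
theorem IsState.smul_mulLeft {s : diagonalAlgebra →L[ℂ] ℂ} (hs : IsState s) {S : Set ℕ} {θ : ℝ}
    (hθ : 0 < θ) (h : s (proj S) = θ) :
    IsState ((θ : ℂ)⁻¹ • s.comp (ContinuousLinearMap.mul ℂ diagonalAlgebra (proj S))) := by
  constructor
  · intro a ha
    change 0 ≤ (θ : ℂ)⁻¹ * s (proj S * a)
    refine mul_nonneg ?_ (hs.1 _ (proj_mul_nonneg S ha))
    rw [← Complex.ofReal_inv]
    exact Complex.zero_le_real.2 (inv_pos.2 hθ).le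
  · change (θ : ℂ)⁻¹ * s (proj S * 1) = 1
    rw [mul_one, h]
    exact inv_mul_cancel₀ (Complex.ofReal_ne_zero.2 hθ.ne')

theorem IsPureState.proj_eq {s : diagonalAlgebra →L[ℂ] ℂ} (hs : IsPureState s) (S : Set ℕ) :
    s (proj S) = 0 ∨ s (proj S) = 1 := by
  have hsum : s (proj S) + s (proj Sᶜ) = 1 := by
    rw [← map_add, proj_add_proj_compl, hs.1.2]
  obtain ⟨hre, him⟩ := Complex.nonneg_iff.1 (hs.1.1 _ (proj_nonneg S))
  obtain ⟨hre', -⟩ := Complex.nonneg_iff.1 (hs.1.1 _ (proj_nonneg Sᶜ))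
  set θ := (s (proj S)).re with hθ
  have h1 : s (proj S) = θ := Complex.ext rfl him.symm
  have h2 : s (proj Sᶜ) = ((1 - θ : ℝ) : ℂ) := by
    rw [h1] at hsum
    push_cast
    exact eq_sub_of_add_eq' hsum
  rcases hre.eq_or_lt with h0 | h0
  · left
    rw [h1, ← h0, Complex.ofReal_zero]
  rcases (sub_nonneg.1 ((congrArg Complex.re h2).trans (Complex.ofReal_re _) ▸ hre')).eq_or_lt
    with h3 | h3
  · right
    rw [h1, h3, Complex.ofReal_one]
  exfalso
  have hθ0 : (θ : ℂ) ≠ 0 := Complex.ofReal_ne_zero.2 h0.ne'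
  have hθ1 : ((1 - θ : ℝ) : ℂ) ≠ 0 := Complex.ofReal_ne_zero.2 (sub_pos.2 h3).ne'
  -- By purity `s` equals its conditioning on `S`, which has value 1 at `proj S`.
  have key := (hs.2 _ _ θ (hs.1.smul_mulLeft h0 h1) (hs.1.smul_mulLeft (sub_pos.2 h3) h2) h0 h3
    (by
      rw [smul_inv_smul₀ hθ0, smul_inv_smul₀ hθ1]
      ext a
      change s a = s (proj S * a) + s (proj Sᶜ * a)
      rw [← map_add, ← add_mul, proj_add_proj_compl, one_mul])).1
  have h4 : (θ : ℂ)⁻¹ * s (proj S * proj S) = s (proj S) := congrArg (fun f => f (proj S)) key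
  rw [proj_mul_self, h1, inv_mul_cancel₀ hθ0] at h4
  exact h3.ne (Complex.ofReal_injective (h4.symm.trans Complex.ofReal_one.symm))

theorem proj_eq_sum {ι : Type*} [Fintype ι] (S : Set ℕ) (col : ℕ → ι) :
    proj S = ∑ c, proj {n | n ∈ S ∧ col n = c} := by
  classical
  refine diagonal_ext fun n => ?_
  have : entry ((∑ c, proj {n | n ∈ S ∧ col n = c} : diagonalAlgebra) : BEll2) n n =
      ∑ c, entry (proj {n | n ∈ S ∧ col n = c} : BEll2) n n := by
    rw [entry, AddSubmonoidClass.coe_finsetSum, sum_apply, lp.coeFn_sum,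
      Finset.sum_apply]
    rfl
  rw [this]
  simp only [entry_proj, Set.indicator_apply, Set.mem_ofPred_eq, Pi.one_apply]
  by_cases h : n ∈ S <;> simp [h]

theorem IsPureState.exists_proj_eq_one {ι : Type*} [Fintype ι] {s : diagonalAlgebra →L[ℂ] ℂ}
    (hs : IsPureState s) {S : Set ℕ} (hS : s (proj S) = 1) (col : ℕ → ι) :
    ∃ c, s (proj {n | n ∈ S ∧ col n = c}) = 1 := by
  by_contra! h
  have : s (proj S) = 0 := by
    rw [proj_eq_sum S col, map_sum]
    exact Finset.sum_eq_zero fun c _ => (hs.proj_eq _).resolve_right (h c)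
  exact one_ne_zero (hS.symm.trans this)

/-- The paving bound is one-sided, so `A` is paved first and `-A` is then paved inside the class of
mass 1. Bounds on the form are inherited by subsets. -/
theorem IsPureState.exists_formLE_step {s : diagonalAlgebra →L[ℂ] ℂ} (hs : IsPureState s)
    {A : BEll2} (hA : IsSelfAdjoint A) (hdiag : ∀ n, entry A n n = 0) {S : Set ℕ} {M : ℝ}
    (hM : 0 < M) (hS : s (proj S) = 1) (h1 : FormLE A S M) (h2 : FormLE (-A) S M) :
    ∃ S', s (proj S') = 1 ∧ FormLE A S' (9999 / 10000 * M) ∧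
      FormLE (-A) S' (9999 / 10000 * M) := by
  obtain ⟨col, hcol⟩ := exists_paving_upper hA hdiag hM h1 h2
  obtain ⟨c, hc⟩ := hs.exists_proj_eq_one hS col
  have hdiag' : ∀ n, entry (-A) n n = 0 := fun n => by
    change -entry A n n = 0
    rw [hdiag, neg_zero]
  have h3 : FormLE (-A) {n | n ∈ S ∧ col n = c} M := h2.subset fun n hn => hn.1
  have h4 : FormLE (-(-A)) {n | n ∈ S ∧ col n = c} M := by
    rw [neg_neg]
    exact h1.subset fun n hn => hn.1
  obtain ⟨col', hcol'⟩ := exists_paving_upper hA.neg hdiag' hM h3 h4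
  obtain ⟨c', hc'⟩ := hs.exists_proj_eq_one hc col'
  exact ⟨_, hc', (hcol c).subset fun n hn => hn.1, hcol' c'⟩

theorem formLE_of_norm_le {A : BEll2} {M : ℝ} (h : ‖A‖ ≤ M) (S : Set ℕ) : FormLE A S M := by
  intro x _
  calc (inner ℂ x (A x)).re ≤ ‖x‖ * ‖A x‖ := re_inner_le_norm (𝕜 := ℂ) x (A x)
    _ ≤ ‖x‖ * (M * ‖x‖) := by
      gcongr
      exact A.le_of_opNorm_le h x
    _ = M * ‖x‖ ^ 2 := by ring

theorem IsPureState.exists_formLE {s : diagonalAlgebra →L[ℂ] ℂ} (hs : IsPureState s)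
    {A : BEll2} (hA : IsSelfAdjoint A) (hdiag : ∀ n, entry A n n = 0) {ε : ℝ} (hε : 0 < ε) :
    ∃ S, s (proj S) = 1 ∧ FormLE A S ε ∧ FormLE (-A) S ε := by
  have hM : 0 < ‖A‖ + 1 := by positivity
  have hiter : ∀ k : ℕ, ∃ S, s (proj S) = 1 ∧ FormLE A S ((9999 / 10000) ^ k * (‖A‖ + 1)) ∧
      FormLE (-A) S ((9999 / 10000) ^ k * (‖A‖ + 1)) := by
    intro k
    induction k with
    | zero =>
      refine ⟨Set.univ, ?_, formLE_of_norm_le (by simp) _, formLE_of_norm_le (by simp) _⟩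
      have : proj Set.univ = 1 := diagonal_ext fun n => by
        rw [entry_proj, entry_one, Set.indicator_univ, Pi.one_apply]
      rw [this, hs.1.2]
    | succ k ih =>
      obtain ⟨S, hS, h1, h2⟩ := ih
      obtain ⟨S', hS', h3, h4⟩ := hs.exists_formLE_step hA hdiag (by positivity) hS h1 h2
      rw [← mul_assoc, ← pow_succ'] at h3 h4
      exact ⟨S', hS', h3, h4⟩
  obtain ⟨k, hk⟩ := exists_pow_lt_of_lt_one (div_pos hε hM)
    (by norm_num : (9999 / 10000 : ℝ) < 1)
  obtain ⟨S, hS, h1, h2⟩ := hiter k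
  have hle := ((lt_div_iff₀ hM).1 hk).le
  exact ⟨S, hS, fun x hx => (h1 x hx).trans (by gcongr), fun x hx => (h2 x hx).trans (by gcongr)⟩

/-! ### Uniqueness of the extension -/

theorem isSelfAdjoint_proj (S : Set ℕ) : IsSelfAdjoint (proj S : BEll2) :=
  ((ContinuousLinearMap.nonneg_iff_isPositive _).1 (proj_nonneg S)).isSelfAdjoint

theorem inner_proj (S : Set ℕ) (x : Ell2) :
    inner ℂ x ((proj S : BEll2) x) = ((‖(proj S : BEll2) x‖ ^ 2 : ℝ) : ℂ) := by
  have h : (proj S : BEll2) x = (proj S : BEll2) ((proj S : BEll2) x) :=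
    congrArg (fun a : diagonalAlgebra => (a : BEll2) x) (proj_mul_self S).symm
  have h2 := ContinuousLinearMap.adjoint_inner_left (proj S : BEll2) ((proj S : BEll2) x) x
  rw [← ContinuousLinearMap.star_eq_adjoint, (isSelfAdjoint_proj S).star_eq] at h2
  rw [h, ← h2, ← h, inner_self_eq_norm_sq_to_K]
  norm_cast

/-- Splitting `x` along `S` and its complement, the cross terms are absorbed by the inequality `2ab
≤ ηa² + b²/η`. The coefficient of `proj Sᶜ` may be huge: an extension of a state with mass 1 on `S`
does not see it. -/
theorem le_of_formLE {A : BEll2} (hA : IsSelfAdjoint A) {S : Set ℕ} {ε η : ℝ} (hη : 0 < η)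
    (h : FormLE A S ε) :
    0 ≤ ((ε + η : ℝ) : ℂ) • (proj S : BEll2) +
      ((‖A‖ + ‖A‖ ^ 2 / η : ℝ) : ℂ) • (proj Sᶜ : BEll2) - A := by
  refine nonneg_of_inner fun x => ?_
  set y := (proj S : BEll2) x with hy
  set z := (proj Sᶜ : BEll2) x with hz
  have hx : x = y + z := (congrArg (fun a : diagonalAlgebra => (a : BEll2) x)
    (proj_add_proj_compl S)).symm
  have hsymm : ∀ u v : Ell2, inner ℂ (A u) v = inner ℂ u (A v) := fun u v => by
    have := ContinuousLinearMap.adjoint_inner_left A v u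
    rwa [← ContinuousLinearMap.star_eq_adjoint, hA.star_eq] at this
  have him : (inner ℂ x (A x)).im = 0 := by
    rw [← Complex.conj_eq_iff_im, inner_conj_symm, hsymm]
  have hyz : (inner ℂ z (A y)).re = (inner ℂ y (A z)).re := by
    rw [← hsymm, ← inner_conj_symm, Complex.conj_re]
  have h1 : (inner ℂ y (A y)).re ≤ ε * ‖y‖ ^ 2 := h y fun n hn => by
    rw [hy, proj_apply, Set.indicator_of_notMem hn, zero_mul]
  have h2 : (inner ℂ z (A z)).re ≤ ‖A‖ * ‖z‖ ^ 2 :=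
    formLE_of_norm_le le_rfl Set.univ z fun n hn => absurd (Set.mem_univ n) hn
  have h3 : (inner ℂ y (A z)).re ≤ ‖y‖ * (‖A‖ * ‖z‖) :=
    (re_inner_le_norm (𝕜 := ℂ) y (A z)).trans
      (mul_le_mul_of_nonneg_left (A.le_opNorm z) (norm_nonneg y))
  have h4 : 2 * (‖y‖ * (‖A‖ * ‖z‖)) ≤ η * ‖y‖ ^ 2 + ‖A‖ ^ 2 / η * ‖z‖ ^ 2 := by
    have : η * ‖y‖ ^ 2 + ‖A‖ ^ 2 / η * ‖z‖ ^ 2 - 2 * (‖y‖ * (‖A‖ * ‖z‖)) =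
        (η * ‖y‖ - ‖A‖ * ‖z‖) ^ 2 / η := by
      field_simp
      ring
    have h5 : 0 ≤ (η * ‖y‖ - ‖A‖ * ‖z‖) ^ 2 / η := by positivity
    linarith
  have h6 : (inner ℂ x (A x)).re =
      (inner ℂ y (A y)).re + (inner ℂ z (A z)).re + 2 * (inner ℂ y (A z)).re := by
    rw [hx, map_add, inner_add_left, inner_add_right, inner_add_right]
    simp only [Complex.add_re]
    rw [hyz]
    ring
  have h7 : inner ℂ x ((((ε + η : ℝ) : ℂ) • (proj S : BEll2) +
      ((‖A‖ + ‖A‖ ^ 2 / η : ℝ) : ℂ) • (proj Sᶜ : BEll2) - A) x) =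
      (((ε + η) * ‖y‖ ^ 2 + (‖A‖ + ‖A‖ ^ 2 / η) * ‖z‖ ^ 2 : ℝ) : ℂ) - inner ℂ x (A x) := by
    rw [sub_apply, add_apply,
      smul_apply, smul_apply, inner_sub_right,
      inner_add_right, inner_smul_right, inner_smul_right, inner_proj, inner_proj]
    push_cast
    rfl
  rw [h7, Complex.nonneg_iff, Complex.sub_re, Complex.sub_im, Complex.ofReal_re,
    Complex.ofReal_im, him, h6]
  refine ⟨?_, by simp⟩
  nlinarith

theorem IsState.le_of_formLE {s : diagonalAlgebra →L[ℂ] ℂ} (hs : IsState s) {t : BEll2 →L[ℂ] ℂ}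
    (ht : IsState t) (hts : ∀ a : diagonalAlgebra, t (a : BEll2) = s a) {A : BEll2}
    (hA : IsSelfAdjoint A) {S : Set ℕ} (hS : s (proj S) = 1) {ε η : ℝ} (hη : 0 < η)
    (h : FormLE A S ε) : t A ≤ ((ε + η : ℝ) : ℂ) := by
  have h1 := ht.1 _ (KadisonSinger.le_of_formLE hA hη h)
  have h2 : s (proj Sᶜ) = 0 := by
    have : s (proj S) + s (proj Sᶜ) = 1 := by rw [← map_add, proj_add_proj_compl, hs.2]
    rw [hS] at this
    exact add_eq_left.1 this
  rw [map_sub, map_add, map_smul, map_smul, hts, hts, hS, h2, smul_zero, add_zero, smul_eq_mul,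
    mul_one] at h1
  exact sub_nonneg.1 h1

theorem IsPureState.extension_selfAdjoint_eq_zero {s : diagonalAlgebra →L[ℂ] ℂ}
    (hs : IsPureState s) {t : BEll2 →L[ℂ] ℂ} (ht : IsState t)
    (hts : ∀ a : diagonalAlgebra, t (a : BEll2) = s a) {A : BEll2} (hA : IsSelfAdjoint A)
    (hdiag : ∀ n, entry A n n = 0) : t A = 0 := by
  have key : ∀ δ : ℝ, 0 < δ → t A ≤ (δ : ℂ) ∧ -t A ≤ (δ : ℂ) := by
    intro δ hδ
    obtain ⟨S, hS, h1, h2⟩ := hs.exists_formLE hA hdiag (half_pos hδ)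
    have h3 := hs.1.le_of_formLE ht hts hA hS (half_pos hδ) h1
    have h4 := hs.1.le_of_formLE ht hts hA.neg hS (half_pos hδ) h2
    rw [add_halves] at h3 h4
    rw [map_neg] at h4
    exact ⟨h3, h4⟩
  refine Complex.ext (le_antisymm ?_ ?_) (Complex.le_def.1 (key 1 one_pos).1).2
  · exact le_of_forall_pos_le_add fun δ hδ => by
      simpa using (Complex.le_def.1 (key δ hδ).1).1
  · refine neg_nonpos.1 (le_of_forall_pos_le_add fun δ hδ => ?_)
    simpa using (Complex.le_def.1 (key δ hδ).2).1

theorem entry_star (T : BEll2) (n : ℕ) : entry (star T) n n = conj (entry T n n) := by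
  have h := ContinuousLinearMap.adjoint_inner_right T (lp.single 2 n (1 : ℂ) : Ell2)
    (lp.single 2 n (1 : ℂ))
  rw [← ContinuousLinearMap.star_eq_adjoint, lp.inner_single_left, lp.inner_single_right] at h
  simpa [entry] using h

/-- `T + star T` and `I • (T - star T)` are self-adjoint with zero diagonal, and together they
recover `T`. -/
theorem IsPureState.extension_eq_zero {s : diagonalAlgebra →L[ℂ] ℂ} (hs : IsPureState s)
    {t : BEll2 →L[ℂ] ℂ} (ht : IsState t) (hts : ∀ a : diagonalAlgebra, t (a : BEll2) = s a)
    {T : BEll2} (hdiag : ∀ n, entry T n n = 0) : t T = 0 := by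
  have h1 : t (T + star T) = 0 :=
    hs.extension_selfAdjoint_eq_zero ht hts (IsSelfAdjoint.add_star_self T) fun n => by
      change entry T n n + entry (star T) n n = 0
      rw [entry_star, hdiag, map_zero, add_zero]
  have h2 : t (Complex.I • (T - star T)) = 0 := by
    refine hs.extension_selfAdjoint_eq_zero ht hts ?_ fun n => ?_
    · rw [IsSelfAdjoint, star_smul, star_sub, star_star, Complex.star_def, Complex.conj_I, neg_smul,
        ← smul_neg, neg_sub]
    · change Complex.I * (entry T n n - entry (star T) n n) = 0
      rw [entry_star, hdiag, map_zero, sub_zero, mul_zero]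
  rw [map_smul, smul_eq_zero_iff_right Complex.I_ne_zero, map_sub] at h2
  rw [map_add] at h1
  linear_combination (h1 + h2) / 2

theorem IsPureState.existsUnique_extension {s : diagonalAlgebra →L[ℂ] ℂ} (hs : IsPureState s) :
    ∃! t : BEll2 →L[ℂ] ℂ, IsState t ∧ ∀ a : diagonalAlgebra, t (a : BEll2) = s a := by
  refine ⟨s.comp diagPart, ⟨hs.1.comp_diagPart, fun a => ?_⟩, fun t ht => ?_⟩
  · rw [ContinuousLinearMap.comp_apply, diagPart_coe]
  · ext T
    have h := hs.extension_eq_zero ht.1 ht.2 (entry_sub_diagPart T)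
    rw [map_sub, ht.2, sub_eq_zero] at h
    exact h

end KadisonSinger

theorem mainTheorem1
    (s : KadisonSinger.diagonalAlgebra →L[ℂ] ℂ) (hs : KadisonSinger.IsPureState s) :
    ∃! t : KadisonSinger.BEll2 →L[ℂ] ℂ,
      KadisonSinger.IsState t ∧
        ∀ a : KadisonSinger.diagonalAlgebra, t (a : KadisonSinger.BEll2) = s a := by
  exact hs.existsUnique_extension
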